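/- Let $\alpha\in(0,1]$, let $P$ be a probability distribution on $\mathbb R^m$ and let $C:\mathbb R^n\times\mathbb R^m\to\mathbb R^n$ be measurable. For a real random variable $Z$ put $\operatorname{CVaR}_\alpha[Z]=\inf_{\eta\in\mathbb R}\{\eta+\alpha^{-1}\mathbb E[Z-\eta]^+\}$, where $[x]^+=\max(x,0)$. Suppose that, for $\xi\sim P$, the value $F_i(h)=\operatorname{CVaR}_\alpha[C_i(h,\xi)]$ is finite for all $h\in\mathbb R^n$ and $i=1,\dots,n$, and that the map $F=(F_1,\dots,F_n):\mathbb R^n\to\mathbb R^n$ is continuous and strictly monotone, i.e. $(F(x)-F(y))^\top(x-y)>0$ for all $x\ne y$. Let $\mathcal H=\{h\in\mathbb R^n: Ah=b,\ q^i(h)\le 0,\ i=1,\dots,s\}$ be nonempty and compact, where $A\in\mathbb R^{l\times n}$, $b\in\mathbb R^l$ and the functions $q^i:\mathbb R^n\to\mathbb R$ are convex and continuously differentiable. Then there is exactly one $h^*\in\mathcal H$ with $(h-h^*)^\top F(h^*)\ge 0$ for all $h\in\mathcal H$, and the following holds for all $B\in\mathbb R$ and $\epsilon>0$. There is $N_\epsilon\in\mathbb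 N$ (depending on $\alpha,P,C,\mathcal H,B,\epsilon$ only) such that for all step sizes $\gamma^k>0$ with $\sum_k\gamma^k=\infty$ and $\sum_k(\gamma^k)^2<\infty$, all $h^0\in\mathcal H$, all sequences $(N_k)_{k\ge0}$ in $\mathbb N$ with $N_k\ge N_\epsilon$ for all $k$, and all independent samples $\xi_{k,j}$ ($k\ge 0$, $1\le j\le N_k$) with law $P$, the iterates $$h^{k+1}=\Pi_{\mathcal H}\big(h^k-\gamma^k\widehat F^{N_k}(h^k)\big),\qquad \widehat F^{N_k}_i(h)=\inf_{t\in\mathbb R}\Big\{t+\frac1{N_k\alpha}\sum_{j=1}^{N_k}\big[C_i(h,\xi_{k,j})-t\big]^+\Big\},$$ where $\Pi_{\mathcal H}$ is the Euclidean projection onto $\mathcal H$, satisfy the following: if almost surely $\|\widehat F^{N_k}(h^k)-F(h^k)\|\le B$ for all $k$, then almost surely $$\limsup_{k\to\infty}\|h^k-h^*\|\le\epsilon.$$ -/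

import Mathlib

open MeasureTheory ProbabilityTheory Filter Topology

noncomputable section

namespace CVaRVI

/-- `ℝⁿ` with the Euclidean norm. -/
abbrev E (n : ℕ) : Type := EuclideanSpace ℝ (Fin n)

/-- The function `η ↦ η + α⁻¹ 𝔼[Z - η]⁺`. -/
def cvarObjective {S : Type*} [MeasurableSpace S] (α : ℝ) (P : Measure S) (Z : S → ℝ)
    (η : ℝ) : ℝ :=
  η + α⁻¹ * ∫ x, max (Z x - η) 0 ∂P

/-- `CVaR_α[Z] = inf_η {η + α⁻¹ 𝔼[Z - η]⁺}`. -/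
def cvar {S : Type*} [MeasurableSpace S] (α : ℝ) (P : Measure S) (Z : S → ℝ) : ℝ :=
  ⨅ η : ℝ, cvarObjective α P Z η

/-- The infimum defining `CVaR_α[Z]` is a real number: the expectations are finite and
the infimum is not `-∞`. -/
def HasFiniteCVaR {S : Type*} [MeasurableSpace S] (α : ℝ) (P : Measure S) (Z : S → ℝ) : Prop :=
  (∀ η : ℝ, Integrable (fun x => max (Z x - η) 0) P) ∧
    BddBelow (Set.range (cvarObjective α P Z))

/-- The empirical estimate `inf_η {η + (N α)⁻¹ ∑ⱼ [zⱼ - η]⁺}` from a sample `z₁, …, z_N`. -/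
def empCVaR (α : ℝ) {N : ℕ} (z : Fin N → ℝ) : ℝ :=
  ⨅ η : ℝ, (η + ((N : ℝ) * α)⁻¹ * ∑ j, max (z j - η) 0)

variable {n m : ℕ}

/-- The map `F`, `F_i(h) = CVaR_α[C_i(h, ξ)]` with `ξ ∼ P`. -/
def cvarMap (α : ℝ) (P : Measure (E m)) (C : E n → E m → E n) (h : E n) : E n :=
  WithLp.toLp 2 fun i => cvar α P fun x => C h x i

/-- The estimator of `F(h)` from the sample `x₁, …, x_N` of `ξ`, which is common to all
components. -/
def empMap (α : ℝ) (C : E n → E m → E n) {N : ℕ} (x : Fin N → E m) (h : E n) : E n :=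
  WithLp.toLp 2 fun i => empCVaR α fun j => C h (x j) i

/-- `F` is strictly monotone on `ℝⁿ`. -/
def StrictlyMonotone (F : E n → E n) : Prop :=
  ∀ x y : E n, x ≠ y → 0 < inner ℝ (F x - F y) (x - y)

/-- The solution set `SOL(H, F)` of the variational inequality. -/
def viSol (H : Set (E n)) (F : E n → E n) : Set (E n) :=
  {x | x ∈ H ∧ ∀ y ∈ H, 0 ≤ inner ℝ (y - x) (F x)}

/-- The set `{h | A h = b, qⁱ(h) ≤ 0 for all i}`. -/
def feasibleSet {l s : ℕ} (A : Matrix (Fin l) (Fin n) ℝ) (b : Fin l → ℝ)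
    (q : Fin s → E n → ℝ) : Set (E n) :=
  {h | A.mulVec h.ofLp = b ∧ ∀ i, q i h ≤ 0}

/-- Euclidean projection: a point of `H` nearest to `x` (there is exactly one if `H` is
nonempty, closed and convex). -/
def proj (H : Set (E n)) (x : E n) : E n :=
  Classical.epsilon fun y => y ∈ H ∧ ∀ z ∈ H, ‖x - y‖ ≤ ‖x - z‖

/-- The iterates `h^{k+1} = Π_H (h^k - γ^k F̂^{N_k}(h^k))`, where `F̂^{N_k}` is computed from the
samples `ξ k j`, `j : Fin (N k)`, drawn at iteration `k`. -/
def iterates {Ω : Type*} (α : ℝ) (C : E n → E m → E n) (H : Set (E n)) (γ : ℕ → ℝ)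
    (N : ℕ → ℕ) (ξ : (k : ℕ) → Fin (N k) → Ω → E m) (h₀ : E n) : ℕ → Ω → E n
  | 0, _ => h₀
  | k + 1, ω =>
      proj H (iterates α C H γ N ξ h₀ k ω -
        γ k • empMap α C (fun j => ξ k j ω) (iterates α C H γ N ξ h₀ k ω))

/-- The estimation error `β̂^{N_k} = F̂^{N_k}(h^k) - F(h^k)`. -/
def estError {Ω : Type*} (α : ℝ) (P : Measure (E m)) (C : E n → E m → E n) (H : Set (E n))
    (γ : ℕ → ℝ) (N : ℕ → ℕ) (ξ : (k : ℕ) → Fin (N k) → Ω → E m) (h₀ : E n) (k : ℕ) (ω : Ω) :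
    E n :=
  empMap α C (fun j => ξ k j ω) (iterates α C H γ N ξ h₀ k ω) -
    cvarMap α P C (iterates α C H γ N ξ h₀ k ω)

end CVaRVI

end

/-! Existence goes through Minty. For finitely many test points, a minimax argument produces a weak
solution. Compactness extends it to all of `H`, and continuity turns weak into strong. Strict
monotonicity gives uniqueness.

For convergence, follow `V k = ‖h^k - h*‖²`. By compactness, `⟨F h, h - h*⟩ ≥ c > 0` on the part of
`H` at distance at least `ε / 2` from `h*`. The error term `⟨β^k, h^k - h*⟩` splits into its
conditional mean `g k` given the earlier samples and a bounded martingale difference `Y k`. The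
series `∑ γ k * Y k` converges almost surely, because the martingale is bounded in `L²`. So only `|g
k| ≤ c / 2` is needed. Then `V` falls at rate `c * γ k` away from `h*`, up to perturbations with
convergent sum (`eventually_le_add_of_drift`).

One sample size must make `g k` small for all iterates, although nothing is assumed about the tails
of `C`. The almost sure error bound `B` supplies this: if a cost exceeded its CVaR by more than `B`
with positive probability, all samples could do so at once, and so would the empirical CVaR. The
costs at almost every iterate thus lie within `B` of their CVaR, and for such data the empirical
CVaR converges in mean at a rate depending only on `α` and `B`
(`exists_forall_integral_abs_empCVaR_sub_cvar_le`). -/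

namespace CVaRVI

/-! ### Existence and uniqueness for monotone variational inequalities -/

section VariationalInequality

variable {n : ℕ}

/-- A matrix game whose payoff is nonnegative on the diagonal of the simplex has a mixed strategy
with nonnegative payoff against every pure strategy. -/
lemma exists_stdSimplex_forall_nonneg {ι : Type*} [Fintype ι] [DecidableEq ι] [Nonempty ι]
    (a : Matrix ι ι ℝ)
    (ha : ∀ w ∈ stdSimplex ℝ ι, 0 ≤ ∑ i, ∑ j, w i * a i j * w j) :
    ∃ w ∈ stdSimplex ℝ ι, ∀ i, 0 ≤ ∑ j, a i j * w j := by
  set f := Matrix.toLinearMap₂' ℝ (S₁ := ℝ) (S₂ := ℝ) a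
  have hf : ∀ x y, f x y = ∑ i, ∑ j, x i * a i j * y j := fun x y => by
    simp only [f, Matrix.toLinearMap₂'_apply]
    simp [mul_comm, mul_left_comm]
  have hc := convex_stdSimplex ℝ ι
  have hk := isCompact_stdSimplex ℝ ι
  have hne : (stdSimplex ℝ ι).Nonempty := ⟨_, single_mem_stdSimplex ℝ (Classical.arbitrary ι)⟩
  obtain ⟨u, hu, w, hw, huw⟩ := Sion.exists_isSaddlePointOn' (f := fun x y => f x y) hne hk
    (fun y _ => (LinearMap.continuous_of_finiteDimensional
      (f.flip y)).lowerSemicontinuous.lowerSemicontinuousOn _)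
    (fun y _ => ((f.flip y).convexOn hc).quasiconvexOn) hc hk
    (fun x _ => (LinearMap.continuous_of_finiteDimensional
      (f x)).upperSemicontinuous.upperSemicontinuousOn _)
    (fun x _ => ((f x).concaveOn hc).quasiconcaveOn) hc hne
  refine ⟨w, hw, fun i => ?_⟩
  -- The saddle inequality at the pair of the pure strategy `i` and `u` reads `f u u ≤ f eᵢ w`,
  -- where `eᵢ` is that vertex.
  have h1 := huw _ (single_mem_stdSimplex ℝ i) u hu
  have h2 := ha u hu
  simp only [hf] at h1
  refine (h2.trans h1).trans_eq ?_
  rw [Finset.sum_eq_single i]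
  · simp
  · intro b _ hb; simp [Pi.single_eq_of_ne hb]
  · simp

/-- A monotone map has a weak solution of the variational inequality with respect to finitely many
test points. -/
lemma exists_forall_inner_nonneg_of_finset {H : Set (E n)} (hconv : Convex ℝ H)
    (hne : H.Nonempty) {F : E n → E n} (hF : ∀ x y, 0 ≤ inner ℝ (F x - F y) (x - y))
    (u : Finset H) : ∃ x ∈ H, ∀ y ∈ u, 0 ≤ inner ℝ (F y) ((y : E n) - x) := by
  classical
  rcases u.eq_empty_or_nonempty with rfl | hu
  · obtain ⟨x, hx⟩ := hne
    exact ⟨x, hx, by simp⟩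
  have : Nonempty u := hu.to_subtype
  -- Symmetrizing in `i` and `j` turns twice this sum into a nonnegative combination of monotonicity
  -- products.
  have key : ∀ w ∈ stdSimplex ℝ u, 0 ≤ ∑ i : u, ∑ j : u,
      w i * inner ℝ (F (i : H)) (((i : H) : E n) - (j : H)) * w j := by
    intro w hw
    have h0 : 0 ≤ ∑ i : u, ∑ j : u, w i * w j *
        inner ℝ (F (i : H) - F (j : H)) (((i : H) : E n) - (j : H)) :=
      Finset.sum_nonneg fun i _ => Finset.sum_nonneg fun j _ =>
        mul_nonneg (mul_nonneg (hw.1 i) (hw.1 j)) (hF _ _)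
    have h1 : ∑ i : u, ∑ j : u, w i * w j *
        inner ℝ (F (i : H) - F (j : H)) (((i : H) : E n) - (j : H)) =
        (∑ i : u, ∑ j : u, w i * inner ℝ (F (i : H)) (((i : H) : E n) - (j : H)) * w j) +
        ∑ i : u, ∑ j : u, w j * inner ℝ (F (j : H)) (((j : H) : E n) - (i : H)) * w i := by
      rw [← Finset.sum_add_distrib]
      refine Finset.sum_congr rfl fun i _ => ?_
      rw [← Finset.sum_add_distrib]
      refine Finset.sum_congr rfl fun j _ => ?_
      rw [inner_sub_left, ← neg_sub ((j : H) : E n) ((i : H) : E n), inner_neg_right,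
        inner_neg_right]
      ring
    rw [h1, Finset.sum_comm (f := fun i j : u =>
      w j * inner ℝ (F (j : H)) (((j : H) : E n) - (i : H)) * w i)] at h0
    linarith
  obtain ⟨w, hw, h⟩ := exists_stdSimplex_forall_nonneg
    (fun i j : u => inner ℝ (F (i : H)) (((i : H) : E n) - (j : H))) key
  refine ⟨∑ j : u, w j • ((j : H) : E n),
    hconv.sum_mem (fun i _ => hw.1 i) hw.2 (fun i _ => (i : H).2), fun y hy => ?_⟩
  refine (h ⟨y, hy⟩).trans_eq ?_
  have : (y : E n) - ∑ j : u, w j • ((j : H) : E n) = ∑ j : u, w j • ((y : E n) - (j : H)) := by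
    simp_rw [smul_sub, Finset.sum_sub_distrib, ← Finset.sum_smul]
    rw [hw.2, one_smul]
  rw [this, inner_sum]
  simp_rw [inner_smul_right, mul_comm]

/-- **Minty's lemma**: a weak solution of a variational inequality with continuous operator is a
solution. -/
lemma mem_viSol_of_forall_inner_nonneg {H : Set (E n)} (hconv : Convex ℝ H) {F : E n → E n}
    (hF : Continuous F) {x : E n} (hx : x ∈ H) (h : ∀ y ∈ H, 0 ≤ inner ℝ (F y) (y - x)) :
    x ∈ viSol H F := by
  refine ⟨hx, fun y hy => ?_⟩
  -- Test the weak inequality at `x + t • (y - x)`, divide by `t`, and let `t` decrease to `0`.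
  have hlim : Tendsto (fun t : ℝ => inner ℝ (y - x) (F (x + t • (y - x)))) (𝓝[>] 0)
      (𝓝 (inner ℝ (y - x) (F x))) := by
    have : Continuous fun t : ℝ => inner ℝ (y - x) (F (x + t • (y - x))) := by fun_prop
    simpa using (this.tendsto 0).mono_left nhdsWithin_le_nhds
  refine ge_of_tendsto hlim ?_
  filter_upwards [Ioo_mem_nhdsGT (zero_lt_one' ℝ)] with t ht
  have hz := h _ (hconv.add_smul_sub_mem hx hy ⟨ht.1.le, ht.2.le⟩)
  rw [add_sub_cancel_left, inner_smul_right, real_inner_comm] at hz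
  exact nonneg_of_mul_nonneg_right hz ht.1

lemma StrictlyMonotone.inner_nonneg {F : E n → E n} (hF : StrictlyMonotone F) (x y : E n) :
    0 ≤ inner ℝ (F x - F y) (x - y) := by
  by_cases h : x = y
  · simp [h]
  · exact (hF x y h).le

/-- A strictly monotone continuous variational inequality over a nonempty compact convex set has
exactly one solution. -/
theorem StrictlyMonotone.exists_viSol_eq_singleton {H : Set (E n)} (hconv : Convex ℝ H)
    (hcomp : IsCompact H) (hne : H.Nonempty) {F : E n → E n} (hF : StrictlyMonotone F)
    (hFc : Continuous F) : ∃ x, viSol H F = {x} := by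
  -- Each test point cuts out a closed half-space, so the finite intersection property applies.
  obtain ⟨x, hxH, hx⟩ := hcomp.inter_iInter_nonempty
    (fun y : H => {x : E n | 0 ≤ inner ℝ (F y) ((y : E n) - x)})
    (fun y => isClosed_le continuous_const (by fun_prop)) (fun u => by
      obtain ⟨x, hx, h⟩ := exists_forall_inner_nonneg_of_finset hconv hne hF.inner_nonneg u
      exact ⟨x, hx, by simpa using fun a b c => h ⟨a, b⟩ c⟩)
  have hsol : x ∈ viSol H F := mem_viSol_of_forall_inner_nonneg hconv hFc hxH fun y hy => by
    simpa using Set.mem_iInter.1 hx ⟨y, hy⟩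
  refine ⟨x, Set.eq_singleton_iff_unique_mem.2 ⟨hsol, fun y hy => ?_⟩⟩
  by_contra hxy
  have h1 := hsol.2 y hy.1
  have h2 := hy.2 x hsol.1
  have h3 := hF y x hxy
  rw [← neg_sub y x, inner_neg_left] at h2
  rw [inner_sub_left, real_inner_comm, real_inner_comm (y - x) (F x)] at h3
  linarith

lemma convex_feasibleSet {l s : ℕ} (A : Matrix (Fin l) (Fin n) ℝ) (b : Fin l → ℝ)
    {q : Fin s → E n → ℝ} (hq : ∀ i, ConvexOn ℝ Set.univ (q i)) :
    Convex ℝ (feasibleSet A b q) := by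
  intro x hx y hy s t hs ht hst
  refine ⟨?_, fun i => ?_⟩
  · have : (s • x + t • y).ofLp = s • x.ofLp + t • y.ofLp := rfl
    rw [this, Matrix.mulVec_add, Matrix.mulVec_smul, Matrix.mulVec_smul, hx.1, hy.1, ← add_smul,
      hst, one_smul]
  · have h1 := (hq i).2 (Set.mem_univ x) (Set.mem_univ y) hs ht hst
    have h2 := mul_nonpos_of_nonneg_of_nonpos hs (hx.2 i)
    have h3 := mul_nonpos_of_nonneg_of_nonpos ht (hy.2 i)
    simp only [smul_eq_mul] at h1
    linarith

end VariationalInequality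

/-! ### Euclidean projection onto a compact convex set -/

section Projection

variable {n : ℕ} {H : Set (E n)}

lemma proj_spec (hcomp : IsCompact H) (hne : H.Nonempty) (x : E n) :
    proj H x ∈ H ∧ ∀ z ∈ H, ‖x - proj H x‖ ≤ ‖x - z‖ := by
  obtain ⟨y, hy, h⟩ := hcomp.exists_isMinOn hne
    (f := fun z => ‖x - z‖) (by fun_prop)
  exact Classical.epsilon_spec (p := fun y => y ∈ H ∧ ∀ z ∈ H, ‖x - y‖ ≤ ‖x - z‖)
    ⟨y, hy, fun z hz => h hz⟩

lemma inner_sub_proj_le_zero (hconv : Convex ℝ H) (hcomp : IsCompact H) (hne : H.Nonempty)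
    (x : E n) {z : E n} (hz : z ∈ H) : inner ℝ (x - proj H x) (z - proj H x) ≤ 0 := by
  obtain ⟨h1, h2⟩ := proj_spec hcomp hne x
  refine (norm_eq_iInf_iff_real_inner_le_zero hconv h1).1 ?_ z hz
  have : Nonempty H := hne.to_subtype
  exact le_antisymm (le_ciInf fun w => h2 w w.2)
    (ciInf_le ⟨0, Set.forall_mem_range.2 fun _ => norm_nonneg _⟩ (⟨_, h1⟩ : H))

/-- Adding the two obtuse-angle inequalities gives `‖p - r‖² ≤ ⟨x - y, p - r⟩`; Cauchy–Schwarz does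
the rest. -/
lemma norm_proj_sub_proj_le (hconv : Convex ℝ H) (hcomp : IsCompact H) (hne : H.Nonempty)
    (x y : E n) : ‖proj H x - proj H y‖ ≤ ‖x - y‖ := by
  have h1 := inner_sub_proj_le_zero hconv hcomp hne x (proj_spec hcomp hne y).1
  have h2 := inner_sub_proj_le_zero hconv hcomp hne y (proj_spec hcomp hne x).1
  set p := proj H x
  set r := proj H y
  have h3 : ‖p - r‖ ^ 2 ≤ inner ℝ (x - y) (p - r) := by
    rw [← real_inner_self_eq_norm_sq]
    have e : inner ℝ (x - y) (p - r) =
        inner ℝ (p - r) (p - r) - inner ℝ (x - p) (r - p) - inner ℝ (y - r) (p - r) := by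
      rw [← neg_sub p r, inner_neg_right, sub_neg_eq_add, ← inner_add_left, ← inner_sub_left]
      congr 1; abel
    linarith
  have h4 := h3.trans (real_inner_le_norm _ _)
  rcases (norm_nonneg (p - r)).eq_or_lt with h | h
  · rw [← h]; exact norm_nonneg _
  · nlinarith

lemma continuous_proj (hconv : Convex ℝ H) (hcomp : IsCompact H) (hne : H.Nonempty) :
    Continuous (proj H) :=
  (LipschitzWith.of_dist_le_mul (K := 1) fun x y => by
    simpa [dist_eq_norm] using norm_proj_sub_proj_le hconv hcomp hne x y).continuous

lemma proj_eq_self (hcomp : IsCompact H) {x : E n} (hx : x ∈ H) : proj H x = x := by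
  have := (proj_spec hcomp ⟨x, hx⟩ x).2 x hx
  rw [sub_self, norm_zero, norm_le_zero_iff, sub_eq_zero] at this
  exact this.symm

end Projection

/-! ### Elementary bounds and measurability of the empirical CVaR -/

section EmpiricalCVaR

variable {α : ℝ} {N : ℕ}

lemma abs_iInf_sub_iInf_le {ι : Type*} [Nonempty ι] {f g : ι → ℝ} {K : ℝ}
    (hf : BddBelow (Set.range f)) (hg : BddBelow (Set.range g)) (h : ∀ i, |f i - g i| ≤ K) :
    |(⨅ i, f i) - ⨅ i, g i| ≤ K := by
  have h1 : (⨅ i, f i) - K ≤ ⨅ i, g i := le_ciInf fun i => by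
    linarith [ciInf_le hf i, (abs_le.1 (h i)).2]
  have h2 : (⨅ i, g i) - K ≤ ⨅ i, f i := le_ciInf fun i => by
    linarith [ciInf_le hg i, (abs_le.1 (h i)).1]
  exact abs_le.2 ⟨by linarith, by linarith⟩

/-- This is where `α ≤ 1` matters: it gives `η + α⁻¹ * [a - η]⁺ ≥ η + (a - η) = a`. -/
lemma le_empObjective (hα : α ∈ Set.Ioc (0 : ℝ) 1) (hN : 0 < N) {z : Fin N → ℝ} {a : ℝ}
    (ha : ∀ j, a ≤ z j) (η : ℝ) :
    a ≤ η + ((N : ℝ) * α)⁻¹ * ∑ j, max (z j - η) 0 := by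
  have hN' : (0 : ℝ) < N := by exact_mod_cast hN
  have h1 : (N : ℝ) * max (a - η) 0 ≤ ∑ j, max (z j - η) 0 := by
    have := Finset.card_nsmul_le_sum Finset.univ (fun j => max (z j - η) 0) (max (a - η) 0)
      fun j _ => max_le_max_right _ (by linarith [ha j])
    simpa using this
  have h2 : ((N : ℝ) * α)⁻¹ * (N * max (a - η) 0) = α⁻¹ * max (a - η) 0 := by
    have := hα.1.ne'
    field_simp
  have h3 : max (a - η) 0 ≤ α⁻¹ * max (a - η) 0 :=
    le_mul_of_one_le_left (le_max_right _ _) ((one_le_inv₀ hα.1).2 hα.2)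
  have h4 := mul_le_mul_of_nonneg_left h1
    (inv_nonneg.2 (mul_nonneg hN'.le hα.1.le))
  linarith [le_max_left (a - η) 0]

lemma bddBelow_empObjective (hα : α ∈ Set.Ioc (0 : ℝ) 1) (hN : 0 < N) (z : Fin N → ℝ) :
    BddBelow (Set.range fun η : ℝ => η + ((N : ℝ) * α)⁻¹ * ∑ j, max (z j - η) 0) := by
  obtain ⟨a, ha⟩ := (Set.finite_range z).bddBelow
  exact ⟨a, Set.forall_mem_range.2 (le_empObjective hα hN fun j => ha ⟨j, rfl⟩)⟩

lemma lt_empCVaR (hα : α ∈ Set.Ioc (0 : ℝ) 1) (hN : 0 < N) {z : Fin N → ℝ} {a : ℝ}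
    (ha : ∀ j, a < z j) : a < empCVaR α z := by
  have : Nonempty (Fin N) := ⟨⟨0, hN⟩⟩
  obtain ⟨j, hj⟩ := Finite.exists_min z
  exact (ha j).trans_le (le_ciInf (le_empObjective hα hN hj))

/-- At `η` equal to the largest sample value all excesses vanish. -/
lemma empCVaR_lt (hα : α ∈ Set.Ioc (0 : ℝ) 1) (hN : 0 < N) {z : Fin N → ℝ} {a : ℝ}
    (ha : ∀ j, z j < a) : empCVaR α z < a := by
  have : Nonempty (Fin N) := ⟨⟨0, hN⟩⟩
  obtain ⟨j, hj⟩ := Finite.exists_max z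
  refine (ciInf_le (bddBelow_empObjective hα hN z) (z j)).trans_lt ?_
  rw [Finset.sum_eq_zero fun i _ => max_eq_right (sub_nonpos.2 (hj i))]
  simpa using ha j

/-- The objective is continuous in `η`, so the infimum may be taken over the rationals. -/
lemma measurable_empCVaR (α : ℝ) (N : ℕ) : Measurable fun z : Fin N → ℝ => empCVaR α z := by
  have h : ∀ z : Fin N → ℝ, empCVaR α z =
      ⨅ r : ℚ, ((r : ℝ) + ((N : ℝ) * α)⁻¹ * ∑ j, max (z j - r) 0) := fun z => by
    have h := Dense.ciInf' Rat.denseRange_cast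
      (f := fun η : ℝ => η + ((N : ℝ) * α)⁻¹ * ∑ j, max (z j - η) 0) (by fun_prop)
    exact h.symm.trans (Set.rangeFactorization_surjective.iInf_comp _).symm
  simp_rw [h]
  exact Measurable.iInf fun r => by fun_prop

end EmpiricalCVaR

/-! ### Uniform convergence in mean of the empirical CVaR -/

section Concentration

variable {S : Type*} [MeasurableSpace S] {P : Measure S} {α : ℝ}

/-- The deviation of the empirical mean of `[Z - η]⁺` from its expectation. -/
noncomputable def excessDev (P : Measure S) (Z : S → ℝ) {N : ℕ} (x : Fin N → S) (η : ℝ) : ℝ :=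
  (N : ℝ)⁻¹ * ∑ j, max (Z (x j) - η) 0 - ∫ y, max (Z y - η) 0 ∂P

/-- The empirical mean and the expectation are each 1-Lipschitz in `η`. This is what reduces
uniformity in `η` to a finite grid. -/
lemma abs_excessDev_sub_le [IsProbabilityMeasure P] {Z : S → ℝ}
    (hint : ∀ η : ℝ, Integrable (fun x => max (Z x - η) 0) P) {N : ℕ} (hN : 0 < N)
    (x : Fin N → S) (η η' : ℝ) :
    |excessDev P Z x η - excessDev P Z x η'| ≤ 2 * |η - η'| := by
  have hN' : (0 : ℝ) < N := by exact_mod_cast hN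
  have key : ∀ y, |max (Z y - η) 0 - max (Z y - η') 0| ≤ |η - η'| := fun y => by
    refine (abs_max_sub_max_le_abs _ _ _).trans_eq ?_
    rw [sub_sub_sub_cancel_left, abs_sub_comm]
  have h1 : |(N : ℝ)⁻¹ * ∑ j, max (Z (x j) - η) 0 - (N : ℝ)⁻¹ * ∑ j, max (Z (x j) - η') 0|
      ≤ |η - η'| := by
    rw [← mul_sub, ← Finset.sum_sub_distrib, abs_mul, abs_of_pos (inv_pos.2 hN'),
      inv_mul_le_iff₀ hN']
    refine (Finset.abs_sum_le_sum_abs _ _).trans ?_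
    simpa using Finset.sum_le_card_nsmul Finset.univ _ _ fun j _ => key (x j)
  have h2 : |∫ y, max (Z y - η) 0 ∂P - ∫ y, max (Z y - η') 0 ∂P| ≤ |η - η'| := by
    rw [← integral_sub (hint η) (hint η')]
    simpa using norm_integral_le_of_norm_le_const (μ := P)
      (f := fun y => max (Z y - η) 0 - max (Z y - η') 0) (ae_of_all _ key)
  have e : excessDev P Z x η - excessDev P Z x η' =
      ((N : ℝ)⁻¹ * ∑ j, max (Z (x j) - η) 0 - (N : ℝ)⁻¹ * ∑ j, max (Z (x j) - η') 0) -
      (∫ y, max (Z y - η) 0 ∂P - ∫ y, max (Z y - η') 0 ∂P) := by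
    unfold excessDev; ring
  rw [e]
  exact (abs_sub _ _).trans (by linarith)

lemma excessDev_eq_zero {Z : S → ℝ} {a : ℝ} (hZ : ∀ᵐ y ∂P, Z y ≤ a) {N : ℕ} {x : Fin N → S}
    (hx : ∀ j, Z (x j) ≤ a) {η : ℝ} (hη : a ≤ η) : excessDev P Z x η = 0 := by
  have h1 : ∫ y, max (Z y - η) 0 ∂P = 0 := integral_eq_zero_of_ae <| by
    filter_upwards [hZ] with y hy using max_eq_right (by linarith)
  rw [excessDev, h1, Finset.sum_eq_zero fun j _ => max_eq_right (by linarith [hx j])]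
  simp

/-- Below the data the excess is `Z - η`, so lowering `η` shifts the empirical mean and the
expectation equally. -/
lemma excessDev_eq_of_le [IsProbabilityMeasure P] {Z : S → ℝ} {a : ℝ}
    (hint : Integrable (fun x => max (Z x - a) 0) P)
    (hZ : ∀ᵐ y ∂P, a ≤ Z y) {N : ℕ} (hN : 0 < N) {x : Fin N → S}
    (hx : ∀ j, a ≤ Z (x j)) {η : ℝ} (hη : η ≤ a) : excessDev P Z x η = excessDev P Z x a := by
  have hN' : (N : ℝ) ≠ 0 := by exact_mod_cast hN.ne'
  have key : ∀ t, a ≤ t → max (t - η) 0 = max (t - a) 0 + (a - η) := fun t ht => by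
    rw [max_eq_left (by linarith), max_eq_left (by linarith)]; ring
  have h1 : ∫ y, max (Z y - η) 0 ∂P = ∫ y, max (Z y - a) 0 ∂P + (a - η) := by
    have : ∫ y, (max (Z y - a) 0 + (a - η)) ∂P = ∫ y, max (Z y - a) 0 ∂P + (a - η) := by
      rw [integral_add hint (integrable_const _)]; simp
    rw [← this]
    refine integral_congr_ae ?_
    filter_upwards [hZ] with y hy using key _ hy
  rw [excessDev, h1, Finset.sum_congr rfl fun j _ => key _ (hx j), Finset.sum_add_distrib]
  simp only [excessDev, Finset.sum_const, Finset.card_univ, Fintype.card_fin, nsmul_eq_mul]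
  field_simp
  ring

/-- For data in `[c - B, c + B]` the deviation is controlled by its values on a finite grid. -/
lemma abs_excessDev_le_sum [IsProbabilityMeasure P] {Z : S → ℝ} {c B κ : ℝ} (hκ : 0 < κ)
    (hint : ∀ η : ℝ, Integrable (fun x => max (Z x - η) 0) P)
    (hZ : ∀ᵐ y ∂P, |Z y - c| ≤ B) {N : ℕ} (hN : 0 < N) {x : Fin N → S}
    (hx : ∀ j, |Z (x j) - c| ≤ B) (η : ℝ) :
    |excessDev P Z x η| ≤
      ∑ i ∈ Finset.range (⌊2 * B / κ⌋₊ + 1), |excessDev P Z x (c - B + i * κ)| + 2 * κ := by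
  have hsum : ∀ i ∈ Finset.range (⌊2 * B / κ⌋₊ + 1), |excessDev P Z x (c - B + i * κ)| ≤
      ∑ i ∈ Finset.range (⌊2 * B / κ⌋₊ + 1), |excessDev P Z x (c - B + i * κ)| := fun i hi =>
    Finset.single_le_sum (f := fun i : ℕ => |excessDev P Z x (c - B + i * κ)|)
      (fun _ _ => abs_nonneg _) hi
  rcases le_or_gt η (c - B) with h | h
  · rw [excessDev_eq_of_le (hint _) (hZ.mono fun y hy => by linarith [(abs_le.1 hy).1]) hN
      (fun j => by linarith [(abs_le.1 (hx j)).1]) h]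
    have := hsum 0 (by simp)
    simp only [Nat.cast_zero, zero_mul, add_zero] at this
    linarith
  rcases le_or_gt (c + B) η with h' | h'
  · rw [excessDev_eq_zero (hZ.mono fun y hy => by linarith [(abs_le.1 hy).2])
      (fun j => by linarith [(abs_le.1 (hx j)).2]) h', abs_zero]
    positivity
  -- The grid point just to the left of `η`.
  set i := ⌊(η - (c - B)) / κ⌋₊
  have hi1 : (i : ℝ) * κ ≤ η - (c - B) :=
    (le_div_iff₀ hκ).1 (Nat.floor_le (div_nonneg (by linarith) hκ.le))
  have hi2 : η - (c - B) < (i + 1) * κ := (div_lt_iff₀ hκ).1 (Nat.lt_floor_add_one _)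
  have hi : i ∈ Finset.range (⌊2 * B / κ⌋₊ + 1) := by
    rw [Finset.mem_range, Nat.lt_succ_iff]
    exact Nat.floor_mono (div_le_div_of_nonneg_right (by linarith) hκ.le)
  have h1 := abs_excessDev_sub_le hint hN x η (c - B + i * κ)
  have h2 : |η - (c - B + i * κ)| ≤ κ := abs_le.2 ⟨by linarith, by linarith⟩
  have h3 := abs_sub_abs_le_abs_sub (excessDev P Z x η) (excessDev P Z x (c - B + i * κ))
  linarith [hsum i hi]

/-- The two objectives differ by `α⁻¹ * excessDev` at each `η`, and uniform closeness passes to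
infima. -/
lemma abs_empCVaR_sub_cvar_le [IsProbabilityMeasure P] (hα : α ∈ Set.Ioc (0 : ℝ) 1) {Z : S → ℝ}
    (hfin : HasFiniteCVaR α P Z) {N : ℕ} (hN : 0 < N) {x : Fin N → S} {K : ℝ}
    (h : ∀ η, |excessDev P Z x η| ≤ K) :
    |empCVaR α (fun j => Z (x j)) - cvar α P Z| ≤ α⁻¹ * K := by
  refine abs_iInf_sub_iInf_le (bddBelow_empObjective hα hN _) hfin.2 fun η => ?_
  have : η + ((N : ℝ) * α)⁻¹ * ∑ j, max (Z (x j) - η) 0 - cvarObjective α P Z η =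
      α⁻¹ * excessDev P Z x η := by
    rw [cvarObjective, excessDev, mul_inv]; ring
  rw [this, abs_mul, abs_of_pos (inv_pos.2 hα.1)]
  exact mul_le_mul_of_nonneg_left (h η) (inv_nonneg.2 hα.1.le)

/-- The left side is the variance of an i.i.d. mean. As `η ≥ c - B`, the excess lies in `[0, 2 * B]`
and has variance at most `B ^ 2`. -/
lemma integral_excessDev_sq_le [IsProbabilityMeasure P] {Z : S → ℝ} (hZm : Measurable Z)
    {c B η : ℝ} (hB : 0 ≤ B) (hη : c - B ≤ η)
    (hZ : ∀ᵐ y ∂P, |Z y - c| ≤ B) {N : ℕ} (hN : 0 < N) :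
    Integrable (fun x : Fin N → S => excessDev P Z x η ^ 2) (Measure.pi fun _ => P) ∧
      ∫ x : Fin N → S, excessDev P Z x η ^ 2 ∂(Measure.pi fun _ => P) ≤ B ^ 2 / N := by
  have hN' : (0 : ℝ) < N := by exact_mod_cast hN
  set Y : S → ℝ := fun y => max (Z y - η) 0
  have hYm : Measurable Y := by fun_prop
  have hYb : ∀ᵐ y ∂P, Y y ∈ Set.Icc 0 (2 * B) := by
    filter_upwards [hZ] with y hy
    exact ⟨le_max_right _ _, max_le (by linarith [(abs_le.1 hy).2]) (by linarith)⟩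
  have hY2 : MemLp Y 2 P := memLp_of_bounded hYb hYm.aestronglyMeasurable 2
  set T : (Fin N → S) → ℝ := fun x => (N : ℝ)⁻¹ * ∑ j, Y (x j)
  have hT2 : MemLp T 2 (Measure.pi fun _ => P) := by
    refine MemLp.const_mul ?_ _
    exact memLp_finsetSum _ fun j _ => hY2.comp_measurePreserving (measurePreserving_eval _ j)
  have hTm : ∫ x, T x ∂(Measure.pi fun _ => P) = ∫ y, Y y ∂P := by
    rw [integral_const_mul, integral_finsetSum]
    · simp_rw [integral_comp_eval (μ := fun _ : Fin N => P) hYm.aestronglyMeasurable]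
      simp [hN'.ne']
    · exact fun j _ => integrable_comp_eval (μ := fun _ : Fin N => P)
        (hY2.integrable one_le_two)
  have hdev : ∀ x : Fin N → S, excessDev P Z x η = T x - ∫ x, T x ∂(Measure.pi fun _ => P) :=
    fun x => by rw [hTm]; rfl
  simp_rw [hdev]
  refine ⟨(hT2.sub (memLp_const _)).integrable_sq, ?_⟩
  rw [← variance_eq_integral hT2.aemeasurable]
  have hv : Var[T; Measure.pi fun _ => P] = (N : ℝ)⁻¹ * Var[Y; P] := by
    have h := variance_sum_pi (μ := fun _ : Fin N => P) (X := fun _ => Y) fun _ => hY2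
    have hT : T = fun x => (N : ℝ)⁻¹ * (∑ j, fun x : Fin N → S => Y (x j)) x := by
      ext x; simp [T]
    rw [hT, variance_const_mul, h]
    simp
    field_simp
  rw [hv, inv_mul_eq_div]
  refine div_le_div_of_nonneg_right ?_ hN'.le
  simpa using variance_le_sq_of_bounded hYb hYm.aemeasurable

/-- The empirical CVaR converges in mean, uniformly over the random variables taking values in an
interval of given length. -/
theorem exists_forall_integral_abs_empCVaR_sub_cvar_le (hα : α ∈ Set.Ioc (0 : ℝ) 1) {B : ℝ}
    (hB : 0 ≤ B) {δ : ℝ} (hδ : 0 < δ) : ∃ N₀ : ℕ, 0 < N₀ ∧ ∀ N ≥ N₀,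
      ∀ {S : Type*} [MeasurableSpace S] (P : Measure S) [IsProbabilityMeasure P] (Z : S → ℝ)
        (c : ℝ), Measurable Z → HasFiniteCVaR α P Z → (∀ᵐ y ∂P, |Z y - c| ≤ B) →
        ∫ x : Fin N → S, |empCVaR α (fun j => Z (x j)) - cvar α P Z| ∂(Measure.pi fun _ => P)
          ≤ δ := by
  have hα0 := hα.1
  -- After multiplication by `α⁻¹`, the mesh error `2 * κ` costs `δ / 4` and the `M` grid points,
  -- with mean at most `2 * t` each, cost `δ / 2`.
  set κ : ℝ := α * δ / 8
  have hκ : 0 < κ := by positivity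
  set M : ℕ := ⌊2 * B / κ⌋₊ + 1
  have hM : (0 : ℝ) < M := by positivity
  set t : ℝ := α * δ / (4 * M)
  have ht : 0 < t := by positivity
  obtain ⟨N₁, hN₁⟩ := exists_nat_ge (B ^ 2 / t ^ 2)
  refine ⟨N₁ + 1, Nat.succ_pos _, fun N hNN S _ P _ Z c hZm hfin hZ => ?_⟩
  have hN : 0 < N := by omega
  have hN' : (0 : ℝ) < N := by exact_mod_cast hN
  have hNt : B ^ 2 / N ≤ t ^ 2 := by
    have : (N₁ : ℝ) ≤ N := by exact_mod_cast (by omega : N₁ ≤ N)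
    rw [div_le_iff₀ hN', mul_comm, ← div_le_iff₀ (by positivity)]
    linarith
  have hg : ∀ i : ℕ, c - B ≤ c - B + i * κ := fun i => by
    have : 0 ≤ (i : ℝ) * κ := by positivity
    linarith
  have hsq := fun i : ℕ => integral_excessDev_sq_le hZm hB (hg i) hZ hN
  -- Passes from second to first moments; with second moment at most `t ^ 2` the right side has mean
  -- at most `2 * t`.
  have habs : ∀ d : ℝ, |d| ≤ t⁻¹ * d ^ 2 + t := fun d => by
    rw [← sq_abs, ← sub_nonneg]
    have : t⁻¹ * |d| ^ 2 + t - |d| = t⁻¹ * ((|d| - t) ^ 2 + |d| * t) := by field_simp; ring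
    rw [this]; positivity
  have hZx : ∀ᵐ x : Fin N → S ∂(Measure.pi fun _ => P), ∀ j, |Z (x j) - c| ≤ B :=
    ae_all_iff.2 fun j => (Measure.quasiMeasurePreserving_eval (fun _ => P) j).ae hZ
  have hint : Integrable (fun x : Fin N → S =>
      α⁻¹ * (∑ i ∈ Finset.range M, (t⁻¹ * excessDev P Z x (c - B + i * κ) ^ 2 + t) + 2 * κ))
      (Measure.pi fun _ => P) := by
    refine Integrable.const_mul (Integrable.add (integrable_finsetSum _ fun i _ => ?_)
      (integrable_const _)) _
    exact ((hsq i).1.const_mul _).add (integrable_const _)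
  refine (integral_mono_of_nonneg (ae_of_all _ fun _ => abs_nonneg _) hint ?_).trans ?_
  · filter_upwards [hZx] with x hx
    refine abs_empCVaR_sub_cvar_le hα hfin hN fun η => ?_
    refine (abs_excessDev_le_sum hκ hfin.1 hZ hN hx η).trans ?_
    gcongr
    exact habs _
  · rw [integral_const_mul, integral_add _ (integrable_const _), integral_finsetSum]
    · have : ∀ i ∈ Finset.range M, ∫ x : Fin N → S, (t⁻¹ * excessDev P Z x (c - B + i * κ) ^ 2 + t)
          ∂(Measure.pi fun _ => P) ≤ 2 * t := fun i _ => by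
        rw [integral_add ((hsq i).1.const_mul _) (integrable_const _), integral_const_mul]
        have h1 := mul_le_mul_of_nonneg_left ((hsq i).2.trans hNt) (inv_nonneg.2 ht.le)
        have h2 : t⁻¹ * t ^ 2 = t := by field_simp
        simp
        linarith
      have h3 := Finset.sum_le_card_nsmul _ _ _ this
      simp only [Finset.card_range, nsmul_eq_mul] at h3
      have h4 : (M : ℝ) * (2 * t) = α * δ / 2 := by simp only [t]; field_simp; ring
      have h5 : 2 * κ = α * δ / 4 := by simp only [κ]; ring
      simp only [integral_const, probReal_univ, one_smul]
      rw [inv_mul_le_iff₀ hα0]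
      have : 0 < α * δ := by positivity
      linarith
    · exact fun i _ => ((hsq i).1.const_mul _).add (integrable_const _)
    · exact integrable_finsetSum _ fun i _ => ((hsq i).1.const_mul _).add (integrable_const _)

end Concentration

/-! ### A deterministic drift lemma -/

section Drift

/-- A nonnegative sequence that drifts down at rate `c * γ k` while it is at least `ρ`, up to
perturbations with convergent sum, is eventually close to or below `ρ`. -/
lemma eventually_le_add_of_drift {V γ r : ℕ → ℝ} {ρ c d L : ℝ} (hV : ∀ k, 0 ≤ V k)
    (hc : 0 < c) (hγ : ∀ k, 0 ≤ γ k) (hγ0 : Tendsto γ atTop (𝓝 0))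
    (hγs : Tendsto (fun K => ∑ k ∈ Finset.range K, γ k) atTop atTop)
    (hr : Tendsto (fun K => ∑ k ∈ Finset.range K, r k) atTop (𝓝 L))
    (hdown : ∀ k, ρ ≤ V k → V (k + 1) ≤ V k - c * γ k + r k)
    (hup : ∀ k, V (k + 1) ≤ V k + d * γ k + r k) {η : ℝ} (hη : 0 < η) :
    ∀ᶠ k in atTop, V k ≤ ρ + η := by
  set R : ℕ → ℝ := fun K => ∑ k ∈ Finset.range K, r k
  have hR : ∀ k, R (k + 1) = R k + r k := fun k => Finset.sum_range_succ _ _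
  obtain ⟨K₁, hK₁⟩ := Metric.cauchySeq_iff.1 hr.cauchySeq (η / 2) (half_pos hη)
  have hd : ∀ᶠ k in atTop, d * γ k < η / 2 := by
    have : Tendsto (fun k => d * γ k) atTop (𝓝 0) := by simpa using hγ0.const_mul d
    exact this.eventually_lt_const (half_pos hη)
  obtain ⟨K₂, hK₂⟩ := eventually_atTop.1 hd
  set K := max K₁ K₂
  have hRK : ∀ i ≥ K, ∀ j ≥ K, R i - R j < η / 2 := fun i hi j hj => by
    have := hK₁ i ((le_max_left _ _).trans hi) j ((le_max_left _ _).trans hj)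
    rw [Real.dist_eq] at this
    exact (le_abs_self _).trans_lt this
  -- Otherwise the divergent sum of `γ` would drive `V` below zero.
  obtain ⟨k₀, hk₀, hVk₀⟩ : ∃ k ≥ K, V k < ρ := by
    by_contra! hcon
    have hind : ∀ k ≥ K, V k ≤ V K - c * (∑ i ∈ Finset.range k, γ i -
        ∑ i ∈ Finset.range K, γ i) + (R k - R K) := by
      intro k hk
      induction k, hk using Nat.le_induction with
      | base => simp
      | succ k hk ih =>
        rw [hR, Finset.sum_range_succ]
        linarith [hdown k (hcon k hk)]
    obtain ⟨k, hk, hkK⟩ := ((hγs.eventually_ge_atTop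
      (∑ i ∈ Finset.range K, γ i + (V K + η) / c)).and (eventually_ge_atTop K)).exists
    have h1 := hind k hkK
    have h2 := hRK k hkK K le_rfl
    have h3 : c * ((V K + η) / c) ≤
        c * (∑ i ∈ Finset.range k, γ i - ∑ i ∈ Finset.range K, γ i) :=
      mul_le_mul_of_nonneg_left (by linarith) hc.le
    rw [mul_div_cancel₀ _ hc.ne'] at h3
    linarith [hV k]
  -- Here `i` is the last time below `ρ`. The step leaving that region overshoots by at most `η / 2`
  -- plus `r i`; afterwards only the increments of `R` can raise `V`.
  have hinv : ∀ k ≥ k₀, V k < ρ ∨ ∃ i, K ≤ i ∧ V k ≤ ρ + η / 2 + (R k - R i) := by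
    intro k hk
    induction k, hk using Nat.le_induction with
    | base => exact Or.inl hVk₀
    | succ k hk ih =>
      have hkK : K ≤ k := hk₀.trans hk
      rcases lt_or_ge (V k) ρ with h | h
      · refine Or.inr ⟨k, hkK, ?_⟩
        rw [hR]
        linarith [hup k, hK₂ k ((le_max_right _ _).trans hkK)]
      · obtain h' | ⟨i, hi, h'⟩ := ih
        · exact absurd h' h.not_gt
        · refine Or.inr ⟨i, hi, ?_⟩
          rw [hR]
          linarith [hdown k h, mul_nonneg hc.le (hγ k)]
  filter_upwards [eventually_ge_atTop k₀] with k hk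
  rcases hinv k hk with h | ⟨i, hi, h⟩
  · linarith
  · linarith [hRK k (hk₀.trans hk) i hi]

end Drift

/-! ### Conditional expectations and martingale convergence -/

section Martingale

/-- The conditional expectation of a function of an `m`-measurable variable and a variable
independent of `m` is obtained by integrating out the latter. -/
lemma condExp_comp_prodMk_ae_eq_integral {Ω β T : Type*} {m mΩ : MeasurableSpace Ω}
    {μ : Measure Ω} [IsProbabilityMeasure μ] [MeasurableSpace β] [MeasurableSpace T] (hm : m ≤ mΩ)
    {h : Ω → β} (hh : Measurable[m] h) {X : Ω → T} (hX : Measurable X)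
    (hind : Indep m (MeasurableSpace.comap X inferInstance) μ)
    {y : β × T → ℝ} (hy : Measurable y) {K : ℝ} (hK : ∀ p, |y p| ≤ K) :
    (fun ω => ∫ t, y (h ω, t) ∂(μ.map X)) =ᵐ[μ] μ[fun ω => y (h ω, X ω) | m] := by
  have hprob : IsProbabilityMeasure (μ.map X) := Measure.isProbabilityMeasure_map hX.aemeasurable
  have hh' : Measurable h := hh.mono hm le_rfl
  have hg : Measurable fun b => ∫ t, y (b, t) ∂(μ.map X) :=
    (StronglyMeasurable.integral_prod_right' hy.stronglyMeasurable).measurable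
  have hgb : ∀ b, |∫ t, y (b, t) ∂(μ.map X)| ≤ K := fun b => by
    simpa using norm_integral_le_of_norm_le_const (μ := μ.map X) (f := fun t => y (b, t))
      (ae_of_all _ fun t => hK (b, t))
  have hyi : Integrable (fun ω => y (h ω, X ω)) μ :=
    Integrable.of_bound (hy.comp (hh'.prodMk hX)).aestronglyMeasurable K
      (ae_of_all _ fun ω => hK _)
  refine ae_eq_condExp_of_forall_setIntegral_eq hm hyi (fun s _ _ => ?_) (fun s hs _ => ?_)
    (hg.comp hh).stronglyMeasurable.aestronglyMeasurable
  · exact (Integrable.of_bound (hg.comp hh').aestronglyMeasurable K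
      (ae_of_all _ fun ω => hgb _)).integrableOn
  -- Pairing the indicator of `s` with `h` keeps the pair independent of `X`, so the joint law is a
  -- product and Fubini applies.
  · set U : Ω → ℝ := s.indicator 1
    have hUm : Measurable[m] U := Measurable.indicator measurable_const hs
    have hUh : Measurable fun ω => (U ω, h ω) := (hUm.prodMk hh).mono hm le_rfl
    have hindf : IndepFun (fun ω => (U ω, h ω)) X μ :=
      indep_of_indep_of_le_left hind (hUm.prodMk hh).comap_le
    have hmap := (indepFun_iff_map_prod_eq_prod_map_map hUh.aemeasurable hX.aemeasurable).1 hindf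
    have hkm : Measurable fun p : (ℝ × β) × T => p.1.1 * y (p.1.2, p.2) := by fun_prop
    have hki : Integrable (fun p : (ℝ × β) × T => p.1.1 * y (p.1.2, p.2))
        ((μ.map fun ω => (U ω, h ω)).prod (μ.map X)) := by
      rw [← hmap, integrable_map_measure hkm.aestronglyMeasurable (hUh.prodMk hX).aemeasurable]
      refine hyi.bdd_mul (c := 1) (hUm.mono hm le_rfl).aestronglyMeasurable
        (ae_of_all _ fun ω => ?_)
      by_cases hω : ω ∈ s <;> simp [U, hω]
    have e1 : ∫ ω in s, y (h ω, X ω) ∂μ = ∫ ω, U ω * y (h ω, X ω) ∂μ := by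
      rw [← integral_indicator (hm s hs)]
      congr with ω
      by_cases hω : ω ∈ s <;> simp [U, hω]
    have e2 : ∫ ω in s, ∫ t, y (h ω, t) ∂(μ.map X) ∂μ =
        ∫ ω, U ω * ∫ t, y (h ω, t) ∂(μ.map X) ∂μ := by
      rw [← integral_indicator (hm s hs)]
      congr with ω
      by_cases hω : ω ∈ s <;> simp [U, hω]
    have e3 : ∫ ω, U ω * y (h ω, X ω) ∂μ = ∫ p : (ℝ × β) × T, p.1.1 * y (p.1.2, p.2)
        ∂(μ.map fun ω => ((U ω, h ω), X ω)) := by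
      rw [integral_map (hUh.prodMk hX).aemeasurable hkm.aestronglyMeasurable]
    rw [e1, e2, e3, hmap, integral_prod _ hki, integral_map hUh.aemeasurable]
    · simp_rw [integral_const_mul]
    · exact (StronglyMeasurable.integral_prod_right' hkm.stronglyMeasurable).aestronglyMeasurable

/-- A weighted sum of bounded martingale differences converges almost surely if the squares of the
weights are summable. -/
lemma ae_tendsto_sum_mul_of_condExp_eq_zero {Ω : Type*} {mΩ : MeasurableSpace Ω} {μ : Measure Ω}
    [IsProbabilityMeasure μ] {ℱ : Filtration ℕ mΩ} {Y : ℕ → Ω → ℝ} {γ : ℕ → ℝ} {K : ℝ} (hY : ∀ k, StronglyMeasurable[ℱ (k + 1)] (Y k))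
    (hK : ∀ k ω, |Y k ω| ≤ K) (hcond : ∀ k, μ[Y k | ℱ k] =ᵐ[μ] 0)
    (hγ : Summable fun k => γ k ^ 2) :
    ∀ᵐ ω ∂μ, ∃ L, Tendsto (fun k => ∑ j ∈ Finset.range k, γ j * Y j ω) atTop (𝓝 L) := by
  set X : ℕ → Ω → ℝ := fun k ω => ∑ j ∈ Finset.range k, γ j * Y j ω
  have hXs : ∀ k, X (k + 1) = X k + γ k • Y k := fun k => by
    ext ω; simp [X, Finset.sum_range_succ]
  have hXm : ∀ k, StronglyMeasurable[ℱ k] (X k) := fun k =>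
    Finset.stronglyMeasurable_fun_sum _ fun j hj =>
      ((hY j).mono (ℱ.mono (Finset.mem_range.1 hj))).const_mul (γ j)
  have hXb : ∀ k ω, |X k ω| ≤ ∑ j ∈ Finset.range k, |γ j| * K := fun k ω =>
    (Finset.abs_sum_le_sum_abs _ _).trans <| Finset.sum_le_sum fun j _ => by
      rw [abs_mul]; exact mul_le_mul_of_nonneg_left (hK j ω) (abs_nonneg _)
  have hXmeas : ∀ k, AEStronglyMeasurable (X k) μ := fun k =>
    ((hXm k).mono (ℱ.le k)).aestronglyMeasurable
  have hYmeas : ∀ k, AEStronglyMeasurable (Y k) μ := fun k =>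
    ((hY k).mono (ℱ.le _)).aestronglyMeasurable
  have hXi : ∀ k, Integrable (X k) μ := fun k =>
    Integrable.of_bound (hXmeas k) _ (ae_of_all _ (hXb k))
  have hYi : ∀ k, Integrable (Y k) μ := fun k =>
    Integrable.of_bound (hYmeas k) _ (ae_of_all _ (hK k))
  have hXYi : ∀ k, Integrable (fun ω => X k ω * Y k ω) μ := fun k =>
    (hYi k).bdd_mul (hXmeas k) (ae_of_all _ (hXb k))
  have hX2i : ∀ k, Integrable (fun ω => X k ω ^ 2) μ := fun k => by
    simp_rw [sq]
    exact (hXi k).bdd_mul (hXmeas k) (ae_of_all _ (hXb k))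
  have hY2i : ∀ k, Integrable (fun ω => Y k ω ^ 2) μ := fun k => by
    simp_rw [sq]
    exact (hYi k).bdd_mul (hYmeas k) (ae_of_all _ (hK k))
  have hmart : Martingale X ℱ μ := by
    refine martingale_nat hXm hXi fun k => ?_
    rw [hXs]
    have h1 := condExp_add (hXi k) ((hYi k).smul (γ k)) (ℱ k)
    have h2 := condExp_smul (μ := μ) (γ k) (Y k) (ℱ k)
    rw [condExp_of_stronglyMeasurable (ℱ.le k) (hXm k) (hXi k)] at h1
    filter_upwards [h1, h2, hcond k] with ω h1 h2 h3
    rw [h1, Pi.add_apply, h2, Pi.smul_apply, h3]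
    simp
  have horth : ∀ k, ∫ ω, X k ω * Y k ω ∂μ = 0 := fun k => by
    have h1 := condExp_mul_of_stronglyMeasurable_left (hXm k) (hXYi k) (hYi k)
    have h2 : μ[fun ω => X k ω * Y k ω | ℱ k] =ᵐ[μ] 0 := by
      filter_upwards [h1, hcond k] with ω h1 h2
      exact h1.trans (by rw [Pi.mul_apply, h2]; simp)
    have h3 := integral_condExp (μ := μ) (ℱ.le k) 
      (f := fun ω => X k ω * Y k ω)
    rw [integral_congr_ae h2] at h3
    simpa using h3.symm
  -- Orthogonality of increments removes the cross terms.
  have hX2 : ∀ k, ∫ ω, X k ω ^ 2 ∂μ ≤ (∑ j ∈ Finset.range k, γ j ^ 2) * K ^ 2 := by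
    intro k
    induction k with
    | zero => simp [X]
    | succ k ih =>
      have e : ∀ ω, X (k + 1) ω ^ 2 =
          X k ω ^ 2 + ((2 * γ k) * (X k ω * Y k ω) + γ k ^ 2 * Y k ω ^ 2) := fun ω => by
        rw [hXs]; simp only [Pi.add_apply, Pi.smul_apply, smul_eq_mul]; ring
      have hY2 : ∫ ω, Y k ω ^ 2 ∂μ ≤ K ^ 2 := by
        have := integral_mono (hY2i k) (integrable_const (K ^ 2)) fun ω =>
          sq_le_sq' (abs_le.1 (hK k ω)).1 (abs_le.1 (hK k ω)).2
        simpa using this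
      have hi : Integrable (fun ω => (2 * γ k) * (X k ω * Y k ω) + γ k ^ 2 * Y k ω ^ 2) μ :=
        ((hXYi k).const_mul _).add ((hY2i k).const_mul _)
      simp_rw [e]
      rw [integral_add (hX2i k) hi,
        integral_add ((hXYi k).const_mul _) ((hY2i k).const_mul _), integral_const_mul,
        integral_const_mul, horth k, Finset.sum_range_succ, add_mul]
      have := mul_le_mul_of_nonneg_left hY2 (sq_nonneg (γ k))
      linarith
  -- Doob's theorem needs only an `L¹` bound, which follows from `|x| ≤ x ^ 2 + 1`.
  refine hmart.submartingale.exists_ae_tendsto_of_bdd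
    (R := Real.toNNReal ((∑' j, γ j ^ 2) * K ^ 2 + 1)) fun k => ?_
  rw [eLpNorm_one_eq_lintegral_enorm, ← ofReal_integral_norm_eq_lintegral_enorm (hXi k)]
  refine ENNReal.ofReal_le_ofReal ?_
  have h1 : ∫ ω, ‖X k ω‖ ∂μ ≤ ∫ ω, (X k ω ^ 2 + 1) ∂μ :=
    integral_mono (hXi k).norm ((hX2i k).add (integrable_const _)) fun ω => by
      simp only [Real.norm_eq_abs]
      nlinarith [sq_abs (X k ω), sq_nonneg (|X k ω| - 1)]
  rw [integral_add (hX2i k) (integrable_const _)] at h1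
  have h2 : (∑ j ∈ Finset.range k, γ j ^ 2) * K ^ 2 ≤ (∑' j, γ j ^ 2) * K ^ 2 :=
    mul_le_mul_of_nonneg_right (hγ.sum_le_tsum _ fun _ _ => sq_nonneg _) (sq_nonneg _)
  simp only [integral_const, probReal_univ, one_smul] at h1
  linarith [hX2 k]

end Martingale

/-! ### Mean error of the vector estimator -/

section Estimator

variable {n m : ℕ} {α : ℝ}

lemma measurable_empMap (α : ℝ) {C : E n → E m → E n}
    (hC : Measurable fun p : E n × E m => C p.1 p.2) (N : ℕ) :
    Measurable fun p : E n × (Fin N → E m) => empMap α C p.2 p.1 := by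
  refine (WithLp.measurable_toLp 2 _).comp (measurable_pi_lambda _ fun i => ?_)
  refine (measurable_empCVaR α N).comp (measurable_pi_lambda _ fun j => ?_)
  have h1 : Measurable fun p : E n × (Fin N → E m) => C p.1 (p.2 j) :=
    hC.comp (measurable_fst.prodMk ((measurable_pi_apply j).comp measurable_snd))
  exact (EuclideanSpace.proj (𝕜 := ℝ) i).measurable.comp h1

/-- An event for a single sample is null if it is impossible that all of `N > 0` independent
samples lie in it. -/
lemma measure_eq_zero_of_ae_pi_not_forall {S : Type*} [MeasurableSpace S] {P : Measure S}
    [IsProbabilityMeasure P] {N : ℕ} {A : Set S}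
    (h : ∀ᵐ x : Fin N → S ∂(Measure.pi fun _ => P), ¬ ∀ j, x j ∈ A) : P A = 0 := by
  have h1 : Measure.pi (fun _ : Fin N => P) (Set.univ.pi fun _ => A) = 0 := by
    rw [ae_iff] at h
    convert h using 2
    ext x; simp
  rw [Measure.pi_pi] at h1
  simp only [Finset.prod_const] at h1
  exact eq_zero_of_pow_eq_zero h1

/-- An almost sure bound for the estimation error bounds the random costs themselves. -/
lemma ae_abs_sub_cvar_le_of_ae_norm_empMap_sub_le (hα : α ∈ Set.Ioc (0 : ℝ) 1)
    {P : Measure (E m)} [IsProbabilityMeasure P] {C : E n → E m → E n} {h : E n} {B : ℝ} {N : ℕ}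
    (hN : 0 < N) (hB : ∀ᵐ x : Fin N → E m ∂(Measure.pi fun _ => P),
      ‖empMap α C x h - cvarMap α P C h‖ ≤ B) (i : Fin n) :
    ∀ᵐ y ∂P, |C h y i - cvar α P fun x => C h x i| ≤ B := by
  set c := cvar α P fun x => C h x i
  have hi : ∀ᵐ x : Fin N → E m ∂(Measure.pi fun _ => P),
      |empCVaR α (fun j => C h (x j) i) - c| ≤ B := by
    filter_upwards [hB] with x hx
    exact (PiLp.norm_apply_le (empMap α C x h - cvarMap α P C h) i).trans hx
  have h1 : P {y | c + B < C h y i} = 0 := by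
    refine measure_eq_zero_of_ae_pi_not_forall (N := N) ?_
    filter_upwards [hi] with x hx hcon
    have := lt_empCVaR hα hN hcon
    linarith [(abs_le.1 hx).2]
  have h2 : P {y | C h y i < c - B} = 0 := by
    refine measure_eq_zero_of_ae_pi_not_forall (N := N) ?_
    filter_upwards [hi] with x hx hcon
    have := empCVaR_lt hα hN hcon
    linarith [(abs_le.1 hx).1]
  filter_upwards [measure_eq_zero_iff_ae_notMem.1 h1, measure_eq_zero_iff_ae_notMem.1 h2]
    with y hy1 hy2
  simp only [not_lt] at hy1 hy2
  exact abs_le.2 ⟨by linarith, by linarith⟩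

/-- The mean estimation error is small for large samples, uniformly over all data for which the
error is almost surely at most `B`. -/
lemma exists_forall_integral_norm_empMap_sub_le (hα : α ∈ Set.Ioc (0 : ℝ) 1) (n m : ℕ) {B : ℝ}
    (hB : 0 ≤ B) {δ : ℝ} (hδ : 0 < δ) : ∃ N₀ : ℕ, 0 < N₀ ∧ ∀ N ≥ N₀,
      ∀ (P : Measure (E m)) [IsProbabilityMeasure P] (C : E n → E m → E n) (h : E n),
        Measurable (C h) → (∀ i, HasFiniteCVaR α P fun x => C h x i) →
        (∀ᵐ x : Fin N → E m ∂(Measure.pi fun _ => P),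
          ‖empMap α C x h - cvarMap α P C h‖ ≤ B) →
        ∫ x : Fin N → E m, ‖empMap α C x h - cvarMap α P C h‖ ∂(Measure.pi fun _ => P) ≤ δ := by
  -- Each component gets the share `δ / (n + 1)`, which also makes sense for `n = 0`.
  have hn : (0 : ℝ) < n + 1 := by positivity
  obtain ⟨N₀, hN₀, key⟩ :=
    exists_forall_integral_abs_empCVaR_sub_cvar_le hα hB (div_pos hδ hn)
  refine ⟨N₀, hN₀, fun N hN P _ C h hC hfin hae => ?_⟩
  have hCi : ∀ i, Measurable fun y => C h y i := fun i =>
    (EuclideanSpace.proj (𝕜 := ℝ) i).measurable.comp hC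
  have hbound := ae_abs_sub_cvar_le_of_ae_norm_empMap_sub_le hα (hN₀.trans_le hN) hae
  have hi := fun i => key N hN P (fun y => C h y i) _ (hCi i) (hfin i) (hbound i)
  have hint : ∀ i, Integrable (fun x : Fin N → E m =>
      |empCVaR α (fun j => C h (x j) i) - cvar α P fun y => C h y i|)
      (Measure.pi fun _ => P) := fun i => by
    have hm : Measurable fun x : Fin N → E m => empCVaR α (fun j => C h (x j) i) :=
      (measurable_empCVaR α N).comp (measurable_pi_lambda _ fun j =>
        (hCi i).comp (measurable_pi_apply j))
    refine Integrable.of_bound (hm.sub_const _).abs.aestronglyMeasurable B ?_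
    filter_upwards [hae] with x hx
    rw [Real.norm_eq_abs, abs_abs]
    exact (PiLp.norm_apply_le (empMap α C x h - cvarMap α P C h) i).trans hx
  refine (integral_mono_of_nonneg (ae_of_all _ fun _ => norm_nonneg _)
    (integrable_finsetSum Finset.univ fun i _ => hint i) (ae_of_all _ fun x => ?_)).trans ?_
  · have hnorm : ∀ v : E n, ‖v‖ ≤ ∑ i, |v i| := fun v => by
      rw [EuclideanSpace.norm_eq]
      refine Real.sqrt_le_iff.2 ⟨Finset.sum_nonneg fun _ _ => abs_nonneg _, ?_⟩
      exact Finset.sum_sq_le_sq_sum_of_nonneg fun _ _ => abs_nonneg _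
    exact hnorm _
  · rw [integral_finsetSum _ fun i _ => hint i]
    refine (Finset.sum_le_card_nsmul _ _ _ fun i _ => hi i).trans ?_
    simp only [Finset.card_univ, Fintype.card_fin, nsmul_eq_mul]
    rw [mul_div_assoc', div_le_iff₀ hn]
    nlinarith

end Estimator

/-! ### Filtration, independence and measurability of the iterates -/

section Algorithm

variable {n m : ℕ} {Ω : Type*} {mΩ : MeasurableSpace Ω} {μ : Measure Ω} {N : ℕ → ℕ}

/-- The information available before iteration `k`: the samples drawn at earlier iterations. -/
def sampleFiltration (ξ : (k : ℕ) → Fin (N k) → Ω → E m) (hξ : ∀ k j, Measurable (ξ k j)) :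
    Filtration ℕ mΩ where
  seq k := ⨆ i ∈ {i : Σ k, Fin (N k) | i.1 < k}, MeasurableSpace.comap (ξ i.1 i.2) inferInstance
  mono' _ _ hkl := biSup_mono fun _ hi => lt_of_lt_of_le hi hkl
  le' _ := iSup₂_le fun i _ => (hξ i.1 i.2).comap_le

variable {ξ : (k : ℕ) → Fin (N k) → Ω → E m}

lemma measurable_sample_succ (hξ : ∀ k j, Measurable (ξ k j)) (k : ℕ) :
    Measurable[sampleFiltration ξ hξ (k + 1)] fun ω j => ξ k j ω := by
  refine @measurable_pi_lambda _ _ _ (sampleFiltration ξ hξ (k + 1)) _ _ fun j => ?_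
  refine Measurable.of_comap_le ?_
  exact le_iSup₂_of_le (⟨k, j⟩ : Σ k, Fin (N k)) (Nat.lt_succ_self k) le_rfl

/-- The filtration at `k` uses only indices strictly below `k`, disjoint from those of the current
sample. -/
lemma indep_sampleFiltration [IsProbabilityMeasure μ] (hξ : ∀ k j, Measurable (ξ k j))
    (hind : iIndepFun (fun i : (Σ k, Fin (N k)) => ξ i.1 i.2) μ) (k : ℕ) :
    Indep (sampleFiltration ξ hξ k)
      (MeasurableSpace.comap (fun ω j => ξ k j ω) inferInstance) μ := by
  have h := indep_iSup_of_disjoint (fun i : (Σ k, Fin (N k)) => (hξ i.1 i.2).comap_le) hind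
    (S := {i | i.1 < k}) (T := {i | i.1 = k})
    (Set.disjoint_left.2 fun i hi hi' => (Set.mem_ofPred.1 hi).ne hi')
  refine indep_of_indep_of_le_right h ?_
  refine Measurable.comap_le ?_
  refine @measurable_pi_lambda _ _ _ (_) _ _ fun j => ?_
  refine Measurable.of_comap_le ?_
  exact le_iSup₂_of_le (⟨k, j⟩ : Σ k, Fin (N k)) rfl le_rfl

lemma map_sample_eq_pi [IsProbabilityMeasure μ] {P : Measure (E m)}
    (hξ : ∀ k j, Measurable (ξ k j)) (hlaw : ∀ k j, μ.map (ξ k j) = P)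
    (hind : iIndepFun (fun i : (Σ k, Fin (N k)) => ξ i.1 i.2) μ) (k : ℕ) :
    μ.map (fun ω j => ξ k j ω) = Measure.pi fun _ => P := by
  have h := hind.precomp (g := fun j : Fin (N k) => (⟨k, j⟩ : Σ k, Fin (N k)))
    fun _ _ hab => by simpa using hab
  rw [(iIndepFun_iff_map_fun_eq_pi_map fun j => (hξ k j).aemeasurable).1 h]
  simp_rw [hlaw]

variable {α : ℝ} {C : E n → E m → E n} {H : Set (E n)} {γ : ℕ → ℝ} {h₀ : E n}

lemma iterates_mem (hcomp : IsCompact H) (hh₀ : h₀ ∈ H) (k : ℕ) (ω : Ω) :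
    iterates α C H γ N ξ h₀ k ω ∈ H := by
  cases k with
  | zero => exact hh₀
  | succ k => exact (proj_spec hcomp ⟨h₀, hh₀⟩ _).1

lemma measurable_iterates (hC : Measurable fun p : E n × E m => C p.1 p.2) (hconv : Convex ℝ H)
    (hcomp : IsCompact H) (hne : H.Nonempty) (hξ : ∀ k j, Measurable (ξ k j)) (k : ℕ) :
    Measurable[sampleFiltration ξ hξ k] (iterates α C H γ N ξ h₀ k) := by
  induction k with
  | zero => exact @measurable_const _ _ _ (_) _
  | succ k ih =>
    have h1 : Measurable[sampleFiltration ξ hξ (k + 1)] (iterates α C H γ N ξ h₀ k) :=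
      ih.mono ((sampleFiltration ξ hξ).mono k.le_succ) le_rfl
    have h2 : Measurable fun p : E n × (Fin (N k) → E m) => p.1 - γ k • empMap α C p.2 p.1 :=
      measurable_fst.sub (Measurable.fun_const_smul (measurable_empMap α hC (N k)) (γ k))
    have h3 := ((continuous_proj hconv hcomp hne).measurable.comp h2).comp
      (h1.prodMk (measurable_sample_succ hξ k))
    have e : iterates α C H γ N ξ h₀ (k + 1) =
        (proj H ∘ fun p : E n × (Fin (N k) → E m) => p.1 - γ k • empMap α C p.2 p.1) ∘
          fun ω => (iterates α C H γ N ξ h₀ k ω, fun j => ξ k j ω) := rfl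
    rw [e]
    exact h3

end Algorithm

/-! ### Convergence of the perturbed iteration -/

section Convergence

variable {n m : ℕ}

/-- Away from the solution, a strictly monotone map points away from it, uniformly. -/
lemma StrictlyMonotone.exists_pos_le_inner {F : E n → E n} (hF : StrictlyMonotone F)
    (hFc : Continuous F) {H : Set (E n)} (hcomp : IsCompact H) {hstar : E n}
    (hsol : hstar ∈ viSol H F) {ρ : ℝ} (hρ : 0 < ρ) :
    ∃ c > 0, ∀ h ∈ H, ρ ≤ ‖h - hstar‖ → c ≤ inner ℝ (F h) (h - hstar) := by
  have hle : ∀ h ∈ H, inner ℝ (F h - F hstar) (h - hstar) ≤ inner ℝ (F h) (h - hstar) :=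
    fun h hh => by
      have := hsol.2 h hh
      rw [real_inner_comm] at this
      rw [inner_sub_left]
      linarith
  have hcomp' : IsCompact (H ∩ {h | ρ ≤ ‖h - hstar‖}) :=
    hcomp.inter_right (isClosed_le continuous_const (by fun_prop))
  rcases (H ∩ {h | ρ ≤ ‖h - hstar‖}).eq_empty_or_nonempty with he | hne
  · refine ⟨1, one_pos, fun h hh hρh => ?_⟩
    have : h ∈ H ∩ {h | ρ ≤ ‖h - hstar‖} := ⟨hh, hρh⟩
    rw [he] at this
    exact this.elim
  -- The minimum of the strict monotonicity product is positive, as `hstar` is excluded; `hle` drops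
  -- the term with `F hstar`.
  · obtain ⟨x, hx, hmin⟩ := hcomp'.exists_isMinOn hne
      (f := fun h => inner ℝ (F h - F hstar) (h - hstar)) (by fun_prop)
    refine ⟨_, hF x hstar fun hxs => ?_, fun h hh hρh => (hmin ⟨hh, hρh⟩).trans (hle h hh)⟩
    have := hx.2
    simp only [hxs, Set.mem_ofPred_eq, sub_self, norm_zero] at this
    linarith

lemma inner_nonneg_of_mem_viSol {F : E n → E n} (hF : StrictlyMonotone F) {H : Set (E n)}
    {hstar : E n} (hsol : hstar ∈ viSol H F) {h : E n} (hh : h ∈ H) :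
    0 ≤ inner ℝ (F h) (h - hstar) := by
  have h1 := hsol.2 h hh
  have h2 := hF.inner_nonneg h hstar
  rw [real_inner_comm] at h1
  rw [inner_sub_left] at h2
  linarith

lemma norm_proj_sub_sq_le {H : Set (E n)} (hconv : Convex ℝ H) (hcomp : IsCompact H)
    {x : E n} (hx : x ∈ H) (h v : E n) (t : ℝ) :
    ‖proj H (h - t • v) - x‖ ^ 2 ≤
      ‖h - x‖ ^ 2 - 2 * t * inner ℝ v (h - x) + t ^ 2 * ‖v‖ ^ 2 := by
  have h1 := norm_proj_sub_proj_le hconv hcomp ⟨x, hx⟩ (h - t • v) x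
  rw [proj_eq_self hcomp hx] at h1
  have h2 : ‖h - t • v - x‖ ^ 2 =
      ‖h - x‖ ^ 2 - 2 * t * inner ℝ v (h - x) + t ^ 2 * ‖v‖ ^ 2 := by
    rw [sub_right_comm, norm_sub_sq_real, inner_smul_right, norm_smul, mul_pow, Real.norm_eq_abs,
      sq_abs, real_inner_comm]
    ring
  rw [← h2]
  exact pow_le_pow_left₀ (norm_nonneg _) h1 2

/-- Perturbed projected iterations for a strictly monotone variational inequality stay near the
solution if the perturbations are sums of a small term and a term with convergent weighted sum. -/
lemma limsup_norm_sub_le_of_perturbed_iteration {F : E n → E n} (hF : StrictlyMonotone F)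
    (hFc : Continuous F) {H : Set (E n)} (hconv : Convex ℝ H) (hcomp : IsCompact H) {hstar : E n}
    (hsol : hstar ∈ viSol H F) {ε c : ℝ} (hε : 0 < ε) (hc : 0 < c)
    (hcF : ∀ h ∈ H, ε / 2 ≤ ‖h - hstar‖ → c ≤ inner ℝ (F h) (h - hstar))
    {γ : ℕ → ℝ} (hγ : ∀ k, 0 < γ k)
    (hγs : Tendsto (fun K => ∑ k ∈ Finset.range K, γ k) atTop atTop)
    (hγ2 : Summable fun k => γ k ^ 2) {h e : ℕ → E n} (hmem : ∀ k, h k ∈ H)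
    (hh : ∀ k, h (k + 1) = proj H (h k - γ k • (F (h k) + e k))) {B : ℝ} (hB : ∀ k, ‖e k‖ ≤ B)
    {Y g : ℕ → ℝ} (hYg : ∀ k, inner ℝ (e k) (h k - hstar) = Y k + g k)
    (hg : ∀ k, |g k| ≤ c / 2) {L : ℝ}
    (hL : Tendsto (fun K => ∑ k ∈ Finset.range K, γ k * Y k) atTop (𝓝 L)) :
    limsup (fun k => ‖h k - hstar‖) atTop ≤ ε := by
  obtain ⟨G, hG⟩ := hcomp.exists_bound_of_continuousOn hFc.continuousOn
  have hγ0 : Tendsto γ atTop (𝓝 0) := by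
    have := hγ2.tendsto_atTop_zero.sqrt
    simpa [Real.sqrt_sq (hγ _).le] using this
  -- The term `-2 * γ k * g k` costs at most `c * γ k`, half of the gain `2 * c * γ k` available far
  -- from `hstar`.
  have hstep : ∀ k, ‖h (k + 1) - hstar‖ ^ 2 ≤ ‖h k - hstar‖ ^ 2 -
      2 * γ k * inner ℝ (F (h k)) (h k - hstar) + c * γ k +
      (γ k ^ 2 * (G + B) ^ 2 + (-2) * (γ k * Y k)) := fun k => by
    have h1 := norm_proj_sub_sq_le hconv hcomp hsol.1 (h k) (F (h k) + e k) (γ k)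
    rw [← hh, inner_add_left, hYg] at h1
    have h2 : ‖F (h k) + e k‖ ^ 2 ≤ (G + B) ^ 2 :=
      pow_le_pow_left₀ (norm_nonneg _)
        ((norm_add_le _ _).trans (add_le_add (hG _ (hmem k)) (hB k))) 2
    have h3 := mul_le_mul_of_nonneg_left h2 (sq_nonneg (γ k))
    have h4 := mul_le_mul_of_nonneg_left (abs_le.1 (hg k)).1 (hγ k).le
    linarith
  have hr : Tendsto
      (fun K => ∑ k ∈ Finset.range K, (γ k ^ 2 * (G + B) ^ 2 + (-2) * (γ k * Y k)))
      atTop (𝓝 ((∑' k, γ k ^ 2 * (G + B) ^ 2) + (-2) * L)) := by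
    simp_rw [Finset.sum_add_distrib, ← Finset.mul_sum]
    exact (hγ2.mul_right _).hasSum.tendsto_sum_nat.add (hL.const_mul _)
  have hfinal := eventually_le_add_of_drift (V := fun k => ‖h k - hstar‖ ^ 2)
    (ρ := (ε / 2) ^ 2) (c := c) (d := c) (fun k => sq_nonneg _) hc (fun k => (hγ k).le) hγ0 hγs hr
    (fun k hk => by
      have h1 := hcF (h k) (hmem k) (le_of_abs_le (abs_le_of_sq_le_sq hk (norm_nonneg _)))
      have h2 := mul_le_mul_of_nonneg_left h1 (hγ k).le
      linarith [hstep k])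
    (fun k => by
      have h1 := mul_nonneg (hγ k).le (inner_nonneg_of_mem_viSol hF hsol (hmem k))
      linarith [hstep k])
    (η := ε ^ 2 - (ε / 2) ^ 2) (by nlinarith)
  refine limsup_le_of_le (isCoboundedUnder_le_of_le atTop fun k => norm_nonneg _) ?_
  filter_upwards [hfinal] with k hk
  rw [add_sub_cancel] at hk
  exact le_of_abs_le (abs_le_of_sq_le_sq hk hε.le)

/-- The projection of the estimation error onto the direction to the solution, set to `0` outside
the event that the iterate is feasible and the error is at most `B`. -/
noncomputable def errorInner (α : ℝ) (P : Measure (E m)) (C : E n → E m → E n) (H : Set (E n))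
    (hstar : E n) (B : ℝ) {N : ℕ} (p : E n × (Fin N → E m)) : ℝ :=
  open Classical in
  if p.1 ∈ H ∧ ‖empMap α C p.2 p.1 - cvarMap α P C p.1‖ ≤ B then
    inner ℝ (empMap α C p.2 p.1 - cvarMap α P C p.1) (p.1 - hstar) else 0

variable {α : ℝ} {P : Measure (E m)} {C : E n → E m → E n} {H : Set (E n)} {hstar : E n}
  {B D : ℝ}

lemma measurable_empMap_sub_cvarMap (hC : Measurable fun p : E n × E m => C p.1 p.2)
    (hFc : Continuous (cvarMap α P C)) (N : ℕ) :
    Measurable fun p : E n × (Fin N → E m) => empMap α C p.2 p.1 - cvarMap α P C p.1 :=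
  (measurable_empMap α hC N).sub (hFc.measurable.comp measurable_fst)

lemma measurable_errorInner (hC : Measurable fun p : E n × E m => C p.1 p.2)
    (hFc : Continuous (cvarMap α P C)) (hcomp : IsCompact H) (N : ℕ) :
    Measurable fun p : E n × (Fin N → E m) => errorInner α P C H hstar B p := by
  have h := measurable_empMap_sub_cvarMap hC hFc N
  refine Measurable.ite ?_ (h.inner (measurable_fst.sub_const _)) measurable_const
  exact (measurable_fst hcomp.measurableSet).inter (measurableSet_le h.norm measurable_const)

lemma abs_errorInner_le_mul_norm (hD : ∀ h ∈ H, ‖h - hstar‖ ≤ D) {N : ℕ}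
    {p : E n × (Fin N → E m)} (hp : p.1 ∈ H) :
    |errorInner α P C H hstar B p| ≤ ‖empMap α C p.2 p.1 - cvarMap α P C p.1‖ * D := by
  have hD0 : 0 ≤ D := (norm_nonneg _).trans (hD _ hp)
  unfold errorInner
  split_ifs with h
  · exact (abs_real_inner_le_norm _ _).trans
      (mul_le_mul_of_nonneg_left (hD _ h.1) (norm_nonneg _))
  · rw [abs_zero]; positivity

/-- The truncation makes this bound hold at every point, as the martingale lemmas require, and not
just almost surely. -/
lemma abs_errorInner_le (hB : 0 ≤ B) (hD0 : 0 ≤ D) (hD : ∀ h ∈ H, ‖h - hstar‖ ≤ D) {N : ℕ}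
    (p : E n × (Fin N → E m)) : |errorInner α P C H hstar B p| ≤ B * D := by
  by_cases h : p.1 ∈ H ∧ ‖empMap α C p.2 p.1 - cvarMap α P C p.1‖ ≤ B
  · exact (abs_errorInner_le_mul_norm hD h.1).trans (mul_le_mul_of_nonneg_right h.2 hD0)
  · rw [errorInner, if_neg h, abs_zero]; positivity

lemma abs_integral_errorInner_le [IsProbabilityMeasure P]
    (hC : Measurable fun p : E n × E m => C p.1 p.2)
    (hFc : Continuous (cvarMap α P C)) (hD : ∀ h ∈ H, ‖h - hstar‖ ≤ D) {N : ℕ} {h : E n}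
    (hh : h ∈ H) (hB : ∀ᵐ x : Fin N → E m ∂(Measure.pi fun _ => P),
      ‖empMap α C x h - cvarMap α P C h‖ ≤ B) :
    |∫ x : Fin N → E m, errorInner α P C H hstar B (h, x) ∂(Measure.pi fun _ => P)| ≤
      (∫ x : Fin N → E m, ‖empMap α C x h - cvarMap α P C h‖ ∂(Measure.pi fun _ => P)) * D := by
  have hp : Measurable fun x : Fin N → E m => (h, x) := measurable_prodMk_left
  have hm := (measurable_empMap_sub_cvarMap hC hFc N).comp hp
  have hi : Integrable (fun x : Fin N → E m => ‖empMap α C x h - cvarMap α P C h‖ * D)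
      (Measure.pi fun _ => P) :=
    (Integrable.of_bound hm.aestronglyMeasurable _ hB).norm.mul_const D
  have hle : ∀ x : Fin N → E m, ‖errorInner α P C H hstar B (h, x)‖ ≤
      ‖empMap α C x h - cvarMap α P C h‖ * D := fun x =>
    abs_errorInner_le_mul_norm (p := (h, x)) hD hh
  have h2 := norm_integral_le_of_norm_le hi (ae_of_all _ hle)
  rwa [integral_mul_const] at h2

variable {Ω : Type*} {mΩ : MeasurableSpace Ω} {μ : Measure Ω} {N : ℕ → ℕ}
  {ξ : (k : ℕ) → Fin (N k) → Ω → E m} {γ : ℕ → ℝ} {h₀ : E n}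

/-- Almost surely, the error bound at an iterate holds for almost all samples. -/
lemma ae_ae_norm_empMap_sub_le [IsProbabilityMeasure P] [IsProbabilityMeasure μ]
    (hC : Measurable fun p : E n × E m => C p.1 p.2)
    (hFc : Continuous (cvarMap α P C)) (hconv : Convex ℝ H) (hcomp : IsCompact H)
    (hne : H.Nonempty) (hξ : ∀ k j, Measurable (ξ k j)) (hlaw : ∀ k j, μ.map (ξ k j) = P)
    (hind : iIndepFun (fun i : (Σ k, Fin (N k)) => ξ i.1 i.2) μ) (k : ℕ)
    (hB : ∀ᵐ ω ∂μ, ‖estError α P C H γ N ξ h₀ k ω‖ ≤ B) :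
    ∀ᵐ ω ∂μ, ∀ᵐ x : Fin (N k) → E m ∂(Measure.pi fun _ => P),
      ‖empMap α C x (iterates α C H γ N ξ h₀ k ω) -
        cvarMap α P C (iterates α C H γ N ξ h₀ k ω)‖ ≤ B := by
  have hhm := measurable_iterates (α := α) (γ := γ) (h₀ := h₀) hC hconv hcomp hne hξ k
  have hh : Measurable (iterates α C H γ N ξ h₀ k) :=
    hhm.mono ((sampleFiltration ξ hξ).le k) le_rfl
  have hX : Measurable fun ω j => ξ k j ω := measurable_pi_lambda _ fun j => hξ k j
  have hindf : IndepFun (iterates α C H γ N ξ h₀ k) (fun ω j => ξ k j ω) μ :=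
    indep_of_indep_of_le_left (indep_sampleFiltration hξ hind k) hhm.comap_le
  have hmap := (indepFun_iff_map_prod_eq_prod_map_map hh.aemeasurable hX.aemeasurable).1 hindf
  rw [map_sample_eq_pi hξ hlaw hind k] at hmap
  have hset : MeasurableSet {p : E n × (Fin (N k) → E m) |
      ‖empMap α C p.2 p.1 - cvarMap α P C p.1‖ ≤ B} :=
    measurableSet_le (measurable_empMap_sub_cvarMap hC hFc _).norm measurable_const
  -- The joint law of iterate and fresh sample is a product, so Fubini splits the almost sure bound.
  have h1 := (ae_map_iff (hh.prodMk hX).aemeasurable hset).2 hB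
  rw [hmap] at h1
  exact ae_of_ae_map hh.aemeasurable (Measure.ae_ae_of_ae_prod h1)

/-- The weighted sums of the centered error terms converge almost surely. -/
lemma ae_tendsto_sum_errorInner [IsProbabilityMeasure P] [IsProbabilityMeasure μ]
    (hC : Measurable fun p : E n × E m => C p.1 p.2)
    (hFc : Continuous (cvarMap α P C)) (hconv : Convex ℝ H) (hcomp : IsCompact H)
    (hne : H.Nonempty) (hξ : ∀ k j, Measurable (ξ k j)) (hlaw : ∀ k j, μ.map (ξ k j) = P)
    (hind : iIndepFun (fun i : (Σ k, Fin (N k)) => ξ i.1 i.2) μ)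
    (hB : 0 ≤ B) (hD0 : 0 ≤ D) (hD : ∀ h ∈ H, ‖h - hstar‖ ≤ D)
    (hγ : Summable fun k => γ k ^ 2) :
    ∀ᵐ ω ∂μ, ∃ L, Tendsto (fun K => ∑ k ∈ Finset.range K, γ k *
      (errorInner α P C H hstar B (iterates α C H γ N ξ h₀ k ω, fun j => ξ k j ω) -
        ∫ x : Fin (N k) → E m, errorInner α P C H hstar B (iterates α C H γ N ξ h₀ k ω, x)
          ∂(Measure.pi fun _ => P))) atTop (𝓝 L) := by
  set ℱ := sampleFiltration ξ hξ
  have hhm := measurable_iterates (α := α) (γ := γ) (h₀ := h₀) hC hconv hcomp hne hξ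
  have hym := fun k => measurable_errorInner (hstar := hstar) (B := B) hC hFc hcomp (N k)
  have hyb := fun k => abs_errorInner_le (α := α) (P := P) (C := C) (N := N k) hB hD0 hD
  have hgm : ∀ k, Measurable fun b : E n => ∫ x : Fin (N k) → E m,
      errorInner α P C H hstar B (b, x) ∂(Measure.pi fun _ => P) := fun k =>
    (StronglyMeasurable.integral_prod_right' (hym k).stronglyMeasurable).measurable
  have hgb : ∀ k (b : E n), |∫ x : Fin (N k) → E m,
      errorInner α P C H hstar B (b, x) ∂(Measure.pi fun _ => P)| ≤ B * D := fun k b => by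
    simpa using norm_integral_le_of_norm_le_const (μ := Measure.pi fun _ : Fin (N k) => P)
      (f := fun x => errorInner α P C H hstar B (b, x)) (ae_of_all _ fun x => hyb k (b, x))
  have hfm : ∀ k, Measurable[ℱ (k + 1)] fun ω =>
      errorInner α P C H hstar B (iterates α C H γ N ξ h₀ k ω, fun j => ξ k j ω) := fun k =>
    (hym k).comp (((hhm k).mono (ℱ.mono k.le_succ) le_rfl).prodMk (measurable_sample_succ hξ k))
  have hghm : ∀ k, Measurable[ℱ k] fun ω => ∫ x : Fin (N k) → E m,
      errorInner α P C H hstar B (iterates α C H γ N ξ h₀ k ω, x) ∂(Measure.pi fun _ => P) :=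
    fun k => (hgm k).comp (hhm k)
  refine ae_tendsto_sum_mul_of_condExp_eq_zero (ℱ := ℱ) (K := 2 * (B * D)) (Y := fun k ω =>
    errorInner α P C H hstar B (iterates α C H γ N ξ h₀ k ω, fun j => ξ k j ω) -
        ∫ x : Fin (N k) → E m, errorInner α P C H hstar B (iterates α C H γ N ξ h₀ k ω, x)
          ∂(Measure.pi fun _ => P)) (fun k => ?_) (fun k ω => ?_) (fun k => ?_) hγ
  · exact ((hfm k).sub ((hghm k).mono (ℱ.mono k.le_succ) le_rfl)).stronglyMeasurable
  · refine (abs_sub _ _).trans ?_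
    linarith [hyb k (iterates α C H γ N ξ h₀ k ω, fun j => ξ k j ω),
      hgb k (iterates α C H γ N ξ h₀ k ω)]
  -- Conditioning freezes the iterate and integrates out the fresh sample, which yields exactly the
  -- subtracted integral.
  · have hX : Measurable fun ω j => ξ k j ω := measurable_pi_lambda _ fun j => hξ k j
    have h1 := condExp_comp_prodMk_ae_eq_integral (ℱ.le k) (hhm k) hX
      (indep_sampleFiltration hξ hind k) (hym k) (hyb k)
    rw [map_sample_eq_pi hξ hlaw hind k] at h1
    have hfi : Integrable (fun ω => errorInner α P C H hstar B
        (iterates α C H γ N ξ h₀ k ω, fun j => ξ k j ω)) μ :=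
      Integrable.of_bound ((hfm k).mono (ℱ.le _) le_rfl).aestronglyMeasurable _
        (ae_of_all _ fun ω => hyb k _)
    have hgi : Integrable (fun ω => ∫ x : Fin (N k) → E m, errorInner α P C H hstar B
        (iterates α C H γ N ξ h₀ k ω, x) ∂(Measure.pi fun _ => P)) μ :=
      Integrable.of_bound ((hghm k).mono (ℱ.le _) le_rfl).aestronglyMeasurable _
        (ae_of_all _ fun ω => hgb k _)
    have h2 := condExp_sub hfi hgi (ℱ k)
    rw [condExp_of_stronglyMeasurable (ℱ.le k) (hghm k).stronglyMeasurable hgi] at h2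
    filter_upwards [h1, h2] with ω h1 h2
    refine h2.trans ?_
    rw [Pi.sub_apply, ← h1, sub_self, Pi.zero_apply]

end Convergence

end CVaRVI

/-! ### The main theorem -/

theorem proposition1 {n m l s : ℕ}
    (α : ℝ) (hα : α ∈ Set.Ioc (0 : ℝ) 1)
    (P : Measure (CVaRVI.E m)) [IsProbabilityMeasure P]
    (C : CVaRVI.E n → CVaRVI.E m → CVaRVI.E n)
    (hC : Measurable fun p : CVaRVI.E n × CVaRVI.E m => C p.1 p.2)
    (hfin : ∀ h i, CVaRVI.HasFiniteCVaR α P fun x => C h x i)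
    (hFmono : CVaRVI.StrictlyMonotone (CVaRVI.cvarMap α P C))
    (hFcont : Continuous (CVaRVI.cvarMap α P C))
    (A : Matrix (Fin l) (Fin n) ℝ) (b : Fin l → ℝ) (q : Fin s → CVaRVI.E n → ℝ)
    (hqconv : ∀ i, ConvexOn ℝ Set.univ (q i)) (hqdiff : ∀ i, ContDiff ℝ 1 (q i))
    (H : Set (CVaRVI.E n)) (hH : H = CVaRVI.feasibleSet A b q)
    (hHne : H.Nonempty) (hHcomp : IsCompact H) :
    ∃ hstar : CVaRVI.E n, CVaRVI.viSol H (CVaRVI.cvarMap α P C) = {hstar} ∧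
      ∀ B : ℝ, ∀ ε : ℝ, 0 < ε → ∃ Nε : ℕ,
        ∀ (γ : ℕ → ℝ), (∀ k, 0 < γ k) →
          Tendsto (fun K => ∑ k ∈ Finset.range K, γ k) atTop atTop →
          Summable (fun k => γ k ^ 2) →
        ∀ h₀ ∈ H, ∀ N : ℕ → ℕ,
        ∀ (Ω : Type*) [MeasurableSpace Ω] (μ : Measure Ω) [IsProbabilityMeasure μ]
          (ξ : (k : ℕ) → Fin (N k) → Ω → CVaRVI.E m),
          (∀ k j, Measurable (ξ k j)) →
          (∀ k j, μ.map (ξ k j) = P) →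
          iIndepFun (fun i : (Σ k, Fin (N k)) => ξ i.1 i.2) μ →
          (∀ᵐ ω ∂μ, ∀ k, ‖CVaRVI.estError α P C H γ N ξ h₀ k ω‖ ≤ B) →
          (∀ k, Nε ≤ N k) →
          ∀ᵐ ω ∂μ,
            limsup (fun k => ‖CVaRVI.iterates α C H γ N ξ h₀ k ω - hstar‖) atTop ≤ ε := by
  have hconv : Convex ℝ H := hH ▸ CVaRVI.convex_feasibleSet A b hqconv
  obtain ⟨hstar, hsol⟩ := hFmono.exists_viSol_eq_singleton hconv hHcomp hHne hFcont
  refine ⟨hstar, hsol, fun B ε hε => ?_⟩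
  have hstar_mem : hstar ∈ CVaRVI.viSol H (CVaRVI.cvarMap α P C) := hsol ▸ rfl
  obtain ⟨c, hc, hcF⟩ := hFmono.exists_pos_le_inner hFcont hHcomp hstar_mem (half_pos hε)
  obtain ⟨D, hD0, hD⟩ : ∃ D > 0, ∀ h ∈ H, ‖h - hstar‖ ≤ D := by
    obtain ⟨D, hD⟩ := hHcomp.exists_bound_of_continuousOn (f := fun h => h - hstar) (by fun_prop)
    exact ⟨max D 1, by positivity, fun h hh => (hD h hh).trans (le_max_left _ _)⟩
  have hB0 : 0 ≤ max B 0 := le_max_right _ _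
  -- A mean error of `c / (2 * D)` against directions of length at most `D` gives a conditional mean
  -- of at most `c / 2`. Neither `c` nor `D` depends on the step sizes or samples.
  obtain ⟨N₀, hN₀, hest⟩ := CVaRVI.exists_forall_integral_norm_empMap_sub_le hα n m hB0
    (δ := c / (2 * D)) (by positivity)
  refine ⟨N₀, fun γ hγ hγs hγ2 h₀ hh₀ N Ω _ μ _ ξ hξ hlaw hind hB hN => ?_⟩
  have hB' : ∀ᵐ ω ∂μ, ∀ k, ‖CVaRVI.estError α P C H γ N ξ h₀ k ω‖ ≤ max B 0 :=
    hB.mono fun ω hω k => (hω k).trans (le_max_left _ _)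
  have hae : ∀ᵐ ω ∂μ, ∀ k, ∀ᵐ x : Fin (N k) → CVaRVI.E m ∂(Measure.pi fun _ => P),
      ‖CVaRVI.empMap α C x (CVaRVI.iterates α C H γ N ξ h₀ k ω) -
        CVaRVI.cvarMap α P C (CVaRVI.iterates α C H γ N ξ h₀ k ω)‖ ≤ max B 0 :=
    ae_all_iff.2 fun k => CVaRVI.ae_ae_norm_empMap_sub_le hC hFcont hconv hHcomp hHne hξ hlaw
      hind k (hB'.mono fun ω hω => hω k)
  filter_upwards [hB', hae, CVaRVI.ae_tendsto_sum_errorInner (h₀ := h₀) hC hFcont hconv hHcomp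
    hHne hξ hlaw hind hB0 hD0.le hD hγ2] with ω hBω haeω ⟨L, hL⟩
  have hmem : ∀ k, CVaRVI.iterates α C H γ N ξ h₀ k ω ∈ H := fun k =>
    CVaRVI.iterates_mem hHcomp hh₀ k ω
  refine CVaRVI.limsup_norm_sub_le_of_perturbed_iteration hFmono hFcont hconv hHcomp hstar_mem hε hc
    hcF hγ hγs hγ2 (e := fun k => CVaRVI.estError α P C H γ N ξ h₀ k ω) hmem (fun k => ?_) hBω
    (g := fun k => ∫ x : Fin (N k) → CVaRVI.E m, CVaRVI.errorInner α P C H hstar (max B 0)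
      (CVaRVI.iterates α C H γ N ξ h₀ k ω, x) ∂(Measure.pi fun _ => P))
    (fun k => ?_) (fun k => ?_) hL
  · rw [CVaRVI.estError, add_sub_cancel, CVaRVI.iterates]
  -- On this event the truncation is inactive.
  · rw [sub_add_cancel, CVaRVI.errorInner, if_pos ⟨hmem k, hBω k⟩, CVaRVI.estError]
  · refine (CVaRVI.abs_integral_errorInner_le hC hFcont hD (hmem k) (haeω k)).trans ?_
    have h1 := hest (N k) (hN k) P C (CVaRVI.iterates α C H γ N ξ h₀ k ω)
      (hC.comp measurable_prodMk_left) (hfin _) (haeω k)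
    refine (mul_le_mul_of_nonneg_right h1 hD0.le).trans_eq ?_
    field_simp
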